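/- Let $d\ge 2$ be an integer. The max-choice preferential attachment tree with $d$ choices is the following random sequence of trees $(P_n)_{n\ge1}$. The tree $P_1$ is the one-edge tree on the vertices $v_1,v_2$. Given $P_1,\dots,P_n$, where $P_n$ is a tree with $n$ edges on the vertices $v_1,\dots,v_{n+1}$, sample vertices $X^1,\dots,X^d$ of $P_n$ independently, each equal to $w$ with probability $\deg_{P_n}(w)/(2n)$, and let $Y$ be one of $X^1,\dots,X^d$ of largest degree in $P_n$; if several of the samples have the largest degree, one of these samples is chosen uniformly at random, independently of the past. The tree $P_{n+1}$ is obtained from $P_n$ by adding a new vertex $v_{n+2}$ and an edge between $v_{n+2}$ and $Y$. Let $M_n$ be the maximum degree of a vertex of $P_n$. If $d=2$, then almost surely $$\lim_{n\to\infty}\frac{M_n\log n}{n}=4 .$$ If $d>2$, then the equation $1-(1-x/2)^d=x$ has exactly one positive solution $x_*$ in the interval $0\le x\le 2$, and almost surely $$\lim_{n\to\infty}\frac{M_n}{n}=x_* .$$ -/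

import Mathlib

open MeasureTheory Filter Topology

noncomputable section

namespace MaxChoice

open Classical in
/-- The probability that `d` independent vertices of the finite graph `G`, each equal to `w` with
probability `deg w / (2 * number of edges)`, are equal to `x 0, …, x (d - 1)`. -/
def sampleProb {n d : ℕ} (G : SimpleGraph (Fin n)) (x : Fin d → Fin n) : ℝ :=
  ∏ i, (G.degree (x i) : ℝ) / (2 * (G.edgeFinset.card : ℝ))

open Classical in
/-- The indices of those samples among `x 0, …, x (d - 1)` whose degree in `G` is largest. -/
def leaders {n d : ℕ} (G : SimpleGraph (Fin n)) (x : Fin d → Fin n) : Finset (Fin d) :=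
  Finset.univ.filter fun i => ∀ j, G.degree (x j) ≤ G.degree (x i)

open Classical in
/-- The probability that the vertex `y` is chosen, given the samples `x`: a uniformly random one
of the samples of largest degree is chosen. -/
def choiceProb {n d : ℕ} (G : SimpleGraph (Fin n)) (x : Fin d → Fin n) (y : Fin n) : ℝ :=
  (((leaders G x).filter fun i => x i = y).card : ℝ) / ((leaders G x).card : ℝ)

/-- The probability that the new vertex is joined to `y` when the current tree is `G`:
`d` vertices are sampled independently with probability proportional to degree, and one
of largest degree is chosen, ties being broken uniformly at random. -/
def attachProb (d : ℕ) {n : ℕ} (G : SimpleGraph (Fin n)) (y : Fin n) : ℝ :=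
  ∑ x : Fin d → Fin n, sampleProb G x * choiceProb G x y

/-- The graph obtained from `G` by adding one new vertex (the last one) and one edge, from the
new vertex to `y`. -/
def attach {n : ℕ} (G : SimpleGraph (Fin n)) (y : Fin n) : SimpleGraph (Fin (n + 1)) :=
  G.map Fin.castSucc ⊔ SimpleGraph.edge (Fin.castSucc y) (Fin.last n)

/-- `P` is a max-choice preferential attachment tree with `d` choices, defined on the probability
space `(Ω, μ)`. The random tree `P n` has `n` edges and the `n + 1` vertices `v₁, …, vₙ₊₁`,
represented by `0, …, n`. It starts from the one-edge tree `P 1`; given the trees up to time `n`,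
the tree `P (n + 1)` is `P n` together with a new vertex joined to `y`, with conditional
probability `attachProb d (P n) y`. The conditional law is stated by elementary conditioning on
each of the finitely many possible histories `g`; `P 0`, the graph with one vertex, carries no
information. -/
structure IsPrefAttachTree (d : ℕ) {Ω : Type*} [MeasurableSpace Ω] (μ : Measure Ω)
    (P : (n : ℕ) → Ω → SimpleGraph (Fin (n + 1))) : Prop where
  measurableSet_eq : ∀ (n : ℕ) (G : SimpleGraph (Fin (n + 1))), MeasurableSet {ω | P n ω = G}
  init : ∀ᵐ ω ∂μ, P 1 ω = ⊤
  step : ∀ n : ℕ, 1 ≤ n → ∀ (g : (k : ℕ) → SimpleGraph (Fin (k + 1))) (y : Fin (n + 1)),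
    μ.real {ω | (∀ k ≤ n, P k ω = g k) ∧ P (n + 1) ω = attach (g n) y} =
      μ.real {ω | ∀ k ≤ n, P k ω = g k} * attachProb d (g n) y

open Classical in
/-- The largest degree of a vertex of `G`. -/
def maxDeg {n : ℕ} (G : SimpleGraph (Fin n)) : ℕ := G.maxDegree

end MaxChoice

end

open MeasureTheory Filter Topology

noncomputable section

namespace MaxChoice

/-! ### Degrees in a growing tree -/

section Degrees

variable {n : ℕ}

/-! Lower bound. If some vertex of largest degree is sampled, the chosen vertex has largest degree,
so `M_n` increases with conditional probability at least `1 - (1 - M_n / (2n)) ^ d`. For a counting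
process `X` with conditional jump probability `p`, `log X` follows the sum of `p / X` up to an
almost surely convergent error: the martingale part is bounded in `L²`, because the expected sum of
`p / X²` is controlled by the telescoping decrease of `1 / X` (`ae_tendsto_sum_log_sub`). What
remains is deterministic. Write `1 - (1 - x/2) ^ d = x * rate d x`, with `rate d` decreasing. As
long as `M_n / n` is below the point where the rate is 1, `log (M_n / n)` is pushed up along the
divergent sum of `1 / n`. For `d = 2` the rate is `1 - x / 4`, equal to 1 only at 0. There `log (M_n
log n / n)` has drift about `(1 - M_n log n / (4n)) / (n log n)`, still of divergent sum, which
vanishes at the value 4. `eventually_gt_of_drift` turns either drift into a bound.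

Upper bound. A fixed vertex is chosen only if it is sampled, so the reverse inequality holds for its
degree, and the same analysis bounds each degree asymptotically. A tie of several hubs prevents this
inequality for `M_n` itself. It is therefore necessary that finitely many vertices carry the maximum
at all times (`ae_exists_hubs`).

Hubs. Choosing the largest degree favours large degrees more than proportionally
(`attachProb_mul_deg_le`). Hence, while `u` leads `v`, the Pólya urn martingale `urn (deg u) (deg
v)` is a supermartingale. It is at least 1 when `v` draws level, so its initial value bounds the
probability of catching up. A new vertex has degree 1, while the lower bound already provides a
vertex of degree at least the square root of the time. The initial value is then exponentially small
in that degree, and Borel–Cantelli applies. -/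

open Classical in
/-- The degree of a vertex, with classical decidability. -/
def deg (G : SimpleGraph (Fin n)) (v : Fin n) : ℕ := G.degree v

theorem deg_eq_card (G : SimpleGraph (Fin n)) (v : Fin n) : deg G v = {w | G.Adj v w}.ncard := by
  classical
  rw [deg, ← SimpleGraph.card_neighborSet_eq_degree, ← Nat.card_eq_fintype_card,
    Nat.card_coe_set_eq]
  rfl

theorem attach_adj_castSucc_castSucc (G : SimpleGraph (Fin n)) (y v w : Fin n) :
    (attach G y).Adj v.castSucc w.castSucc ↔ G.Adj v w := by
  simp only [attach, SimpleGraph.sup_adj, SimpleGraph.edge_adj]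
  have h : (G.map Fin.castSucc).Adj v.castSucc w.castSucc ↔ G.Adj v w :=
    SimpleGraph.map_adj_apply (f := Fin.castSuccEmb)
  rw [h]
  simp [Fin.castSucc_ne_last]

theorem attach_adj_castSucc_last (G : SimpleGraph (Fin n)) (y v : Fin n) :
    (attach G y).Adj v.castSucc (Fin.last n) ↔ v = y := by
  simp only [attach, SimpleGraph.sup_adj, SimpleGraph.edge_adj]
  have h : ¬ (G.map Fin.castSucc).Adj v.castSucc (Fin.last n) := by
    intro h
    obtain ⟨u', v', -, -, h⟩ := (SimpleGraph.map_adj Fin.castSuccEmb G _ _).1 h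
    exact Fin.castSucc_ne_last _ h
  simp [h, Fin.castSucc_ne_last]

/-- The parent `y` is the only neighbour of the new vertex. Hence the possible next trees are
distinct, and the corresponding events are disjoint. -/
theorem attach_injective (G : SimpleGraph (Fin n)) : Function.Injective (attach G) := by
  intro y z h
  have := (attach_adj_castSucc_last G y y).2 rfl
  rw [h] at this
  exact (attach_adj_castSucc_last G z y).1 this

theorem deg_attach_castSucc (G : SimpleGraph (Fin n)) (y v : Fin n) :
    deg (attach G y) v.castSucc = deg G v + if v = y then 1 else 0 := by
  rw [deg_eq_card, deg_eq_card]
  have h : {w | (attach G y).Adj v.castSucc w} =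
      Fin.castSucc '' {w | G.Adj v w} ∪ (if v = y then {Fin.last n} else ∅) := by
    ext w
    induction w using Fin.lastCases with
    | last =>
      have : ∀ x : Fin n, x.castSucc ≠ Fin.last n := fun x => Fin.castSucc_ne_last x
      simp only [Set.mem_ofPred_eq, attach_adj_castSucc_last]
      split_ifs <;> simp_all
    | cast w =>
      have : w.castSucc ≠ Fin.last n := Fin.castSucc_ne_last w
      simp only [Set.mem_ofPred_eq, attach_adj_castSucc_castSucc]
      split_ifs <;> simp_all
  rw [h, Set.ncard_union_eq, Set.ncard_image_of_injective _ (Fin.castSucc_injective n)]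
  · split_ifs <;> simp
  · split_ifs
    · rw [Set.disjoint_singleton_right]
      rintro ⟨x, -, hx⟩
      exact Fin.castSucc_ne_last x hx
    · simp

theorem deg_attach_last (G : SimpleGraph (Fin n)) (y : Fin n) :
    deg (attach G y) (Fin.last n) = 1 := by
  rw [deg_eq_card]
  have h : {w | (attach G y).Adj (Fin.last n) w} = {y.castSucc} := by
    ext w
    induction w using Fin.lastCases with
    | last => simp [(Fin.castSucc_ne_last y).symm]
    | cast w => simp [SimpleGraph.adj_comm _ (Fin.last n), attach_adj_castSucc_last]
  rw [h, Set.ncard_singleton]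

/-- `G` has no isolated vertex, and `m` edges. -/
structure IsGood (m : ℕ) (G : SimpleGraph (Fin n)) : Prop where
  one_le_deg : ∀ v, 1 ≤ deg G v
  sum_deg : ∑ v, deg G v = 2 * m

theorem IsGood.attach {m : ℕ} {G : SimpleGraph (Fin n)} (h : IsGood m G) (y : Fin n) :
    IsGood (m + 1) (attach G y) := by
  constructor
  · intro v
    induction v using Fin.lastCases with
    | last => rw [deg_attach_last]
    | cast v => rw [deg_attach_castSucc]; exact le_add_right (h.one_le_deg v)
  · rw [Fin.sum_univ_castSucc, deg_attach_last]
    simp only [deg_attach_castSucc, Finset.sum_add_distrib, h.sum_deg]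
    simp
    ring

theorem isGood_top : IsGood 1 (⊤ : SimpleGraph (Fin 2)) := by
  have h : ∀ v, deg (⊤ : SimpleGraph (Fin 2)) v = 1 := by
    intro v
    classical
    have h := SimpleGraph.complete_graph_degree (V := Fin 2) v
    rw [Fintype.card_fin] at h
    rw [deg]
    convert h
  constructor <;> simp [h]

theorem deg_lt (G : SimpleGraph (Fin n)) (v : Fin n) : deg G v < n := by
  classical
  simpa [deg] using SimpleGraph.degree_lt_card_verts (G := G) v

theorem deg_le_maxDeg (G : SimpleGraph (Fin n)) (v : Fin n) : deg G v ≤ maxDeg G := by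
  classical
  exact G.degree_le_maxDegree v

theorem exists_deg_eq_maxDeg (G : SimpleGraph (Fin (n + 1))) : ∃ v, deg G v = maxDeg G := by
  classical
  obtain ⟨v, hv⟩ := G.exists_maximal_degree_vertex
  exact ⟨v, hv.symm⟩

/-- Only the degree of `y` grows, and the new leaf cannot exceed the maximum, since a graph without
isolated vertices already has maximum at least 1. -/
theorem maxDeg_attach {m : ℕ} {G : SimpleGraph (Fin (n + 1))} (hG : IsGood m G)
    (y : Fin (n + 1)) :
    maxDeg (attach G y) = maxDeg G + if deg G y = maxDeg G then 1 else 0 := by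
  apply le_antisymm
  · obtain ⟨v, hv⟩ := exists_deg_eq_maxDeg (attach G y)
    rw [← hv]
    induction v using Fin.lastCases with
    | last =>
      rw [deg_attach_last]
      exact le_add_right ((hG.one_le_deg y).trans (deg_le_maxDeg G y))
    | cast v =>
      rw [deg_attach_castSucc]
      have h1 := deg_le_maxDeg G v
      split_ifs with h2 h3 h3
      · omega
      · subst h2; omega
      · omega
      · omega
  · split_ifs with h
    · have := deg_le_maxDeg (attach G y) y.castSucc
      rw [deg_attach_castSucc, if_pos rfl, h] at this
      exact this
    · obtain ⟨v, hv⟩ := exists_deg_eq_maxDeg G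
      have := deg_le_maxDeg (attach G y) v.castSucc
      rw [deg_attach_castSucc, hv] at this
      omega

end Degrees

/-! ### The attachment probabilities -/

section AttachProb

variable {n m d : ℕ} {G : SimpleGraph (Fin n)}

theorem sampleProb_eq (hG : IsGood m G) (x : Fin d → Fin n) :
    sampleProb G x = ∏ i, (deg G (x i) : ℝ) / (2 * m) := by
  classical
  have h : G.edgeFinset.card = m := by
    have h1 := G.sum_degrees_eq_twice_card_edges
    have h2 : ∑ v, G.degree v = 2 * m := by
      rw [← hG.sum_deg]
      rfl
    omega
  rw [sampleProb]
  refine Finset.prod_congr rfl fun i _ => ?_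
  rw [← h, deg]

theorem sampleProb_nonneg (x : Fin d → Fin n) : 0 ≤ sampleProb G x :=
  Finset.prod_nonneg fun _ _ => by positivity

theorem choiceProb_nonneg (x : Fin d → Fin n) (y : Fin n) : 0 ≤ choiceProb G x y := by
  unfold choiceProb; positivity

theorem attachProb_nonneg (y : Fin n) : 0 ≤ attachProb d G y :=
  Finset.sum_nonneg fun x _ => mul_nonneg (sampleProb_nonneg x) (choiceProb_nonneg x y)

theorem mem_leaders {x : Fin d → Fin n} {i : Fin d} :
    i ∈ leaders G x ↔ ∀ j, deg G (x j) ≤ deg G (x i) := by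
  simp [leaders, deg]

theorem leaders_nonempty (hd : 0 < d) (x : Fin d → Fin n) : (leaders G x).Nonempty := by
  have : Nonempty (Fin d) := ⟨⟨0, hd⟩⟩
  obtain ⟨i, hi⟩ := Finite.exists_max fun i => deg G (x i)
  exact ⟨i, mem_leaders.2 hi⟩

theorem sum_choiceProb (hd : 0 < d) (x : Fin d → Fin n) : ∑ y, choiceProb G x y = 1 := by
  classical
  have h0 : ((leaders G x).card : ℝ) ≠ 0 := by
    exact_mod_cast (leaders_nonempty hd x).card_pos.ne'
  unfold choiceProb
  rw [← Finset.sum_div, div_eq_one_iff_eq h0, ← Nat.cast_sum, Nat.cast_inj,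
    Finset.card_eq_sum_card_fiberwise (f := x) (t := Finset.univ) (by simp)]

theorem sum_sampleProb (hG : IsGood m G) (hm : 0 < m) :
    ∑ x : Fin d → Fin n, sampleProb G x = 1 := by
  simp only [sampleProb_eq hG]
  rw [← Fintype.sum_pow (fun v => (deg G v : ℝ) / (2 * m)), ← Finset.sum_div, ← Nat.cast_sum,
    hG.sum_deg]
  have : (m : ℝ) ≠ 0 := by positivity
  push_cast
  rw [div_self (by positivity), one_pow]

theorem sum_attachProb (hG : IsGood m G) (hm : 0 < m) (hd : 0 < d) :
    ∑ y, attachProb d G y = 1 := by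
  unfold attachProb
  rw [Finset.sum_comm]
  simp only [← Finset.mul_sum, sum_choiceProb hd, mul_one, sum_sampleProb hG hm]

/-- The probability that a given vertex is not sampled. -/
theorem sum_sampleProb_avoid (hG : IsGood m G) (hm : 0 < m) (v : Fin n) :
    ∑ x : Fin d → Fin n, sampleProb G x * (if ∃ i, x i = v then 0 else 1) =
      (1 - (deg G v : ℝ) / (2 * m)) ^ d := by
  classical
  have h : ∀ x : Fin d → Fin n, sampleProb G x * (if ∃ i, x i = v then 0 else 1) =
      ∏ i, (if x i = v then 0 else (deg G (x i) : ℝ) / (2 * m)) := by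
    intro x
    split_ifs with hx
    · obtain ⟨i, hi⟩ := hx
      rw [mul_zero, eq_comm]
      exact Finset.prod_eq_zero (Finset.mem_univ i) (if_pos hi)
    · push Not at hx
      simp [hx, sampleProb_eq hG]
  simp only [h]
  rw [← Fintype.sum_pow (fun w => if w = v then (0 : ℝ) else (deg G w : ℝ) / (2 * m))]
  congr 1
  have h2 : ∑ w, (deg G w : ℝ) / (2 * m) = 1 := by
    rw [← Finset.sum_div, ← Nat.cast_sum, hG.sum_deg]
    have : (m : ℝ) ≠ 0 := by positivity
    push_cast
    rw [div_self (by positivity)]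
  rw [← h2, eq_sub_iff_add_eq]
  rw [Finset.sum_ite, Finset.sum_const_zero, zero_add]
  rw [← Finset.sum_erase_add _ _ (Finset.mem_univ v)]
  congr 1
  refine Finset.sum_congr ?_ fun _ _ => rfl
  ext; simp

/-- The probability that a given vertex is sampled. -/
theorem sum_sampleProb_hit (hG : IsGood m G) (hm : 0 < m) (v : Fin n) :
    1 - (1 - (deg G v : ℝ) / (2 * m)) ^ d =
      ∑ x : Fin d → Fin n, sampleProb G x * (if ∃ i, x i = v then 1 else 0) := by
  rw [← sum_sampleProb_avoid hG hm v, sub_eq_iff_eq_add, ← Finset.sum_add_distrib]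
  refine (sum_sampleProb (d := d) hG hm).symm.trans ?_
  refine Finset.sum_congr rfl fun x _ => ?_
  split_ifs <;> simp

/-- A vertex can be chosen only if it is sampled. This is the upper drift bound for a fixed vertex.
-/
theorem attachProb_le (hG : IsGood m G) (hm : 0 < m) (hd : 0 < d) (v : Fin n) :
    attachProb d G v ≤ 1 - (1 - (deg G v : ℝ) / (2 * m)) ^ d := by
  classical
  rw [sum_sampleProb_hit hG hm v]
  refine Finset.sum_le_sum fun x _ => ?_
  refine mul_le_mul_of_nonneg_left ?_ (sampleProb_nonneg x)
  split_ifs with h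
  · rw [← sum_choiceProb (G := G) hd x]
    exact Finset.single_le_sum (fun z _ => choiceProb_nonneg x z) (Finset.mem_univ v)
  · push Not at h
    simp [choiceProb, h]

/-- Once `u` is sampled, every leader has the maximal degree, whichever way ties are broken. This is
the lower drift bound for the maximum. -/
theorem le_sum_attachProb_maxDeg (hG : IsGood m G) (hm : 0 < m) (hd : 0 < d) (u : Fin n)
    (hu : deg G u = maxDeg G) :
    1 - (1 - (maxDeg G : ℝ) / (2 * m)) ^ d ≤
      ∑ y, attachProb d G y * if deg G y = maxDeg G then 1 else 0 := by
  classical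
  rw [← hu, sum_sampleProb_hit hG hm u, hu]
  simp only [attachProb, Finset.sum_mul]
  rw [Finset.sum_comm]
  refine Finset.sum_le_sum fun x _ => ?_
  simp only [mul_assoc, ← Finset.mul_sum]
  refine mul_le_mul_of_nonneg_left ?_ (sampleProb_nonneg x)
  split_ifs with h
  · obtain ⟨i, hi⟩ := h
    refine (sum_choiceProb (G := G) hd x).symm.trans_le (Finset.sum_le_sum fun y _ => ?_)
    split_ifs with hy
    · rw [mul_one]
    · rw [mul_zero]
      have : (leaders G x).filter (fun i => x i = y) = ∅ := by
        rw [Finset.filter_eq_empty_iff]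
        rintro j hj rfl
        have h1 := mem_leaders.1 hj i
        rw [hi] at h1
        exact hy (le_antisymm (deg_le_maxDeg G _) (hu ▸ h1))
      unfold choiceProb
      have h2 : ((leaders G x).filter (fun i => x i = y)).card = 0 := by rw [this]; rfl
      convert (zero_div ((leaders G x).card : ℝ)).le
      exact_mod_cast (by convert h2)
  · exact Finset.sum_nonneg fun y _ => mul_nonneg (choiceProb_nonneg x y) (by split_ifs <;> simp)

/-- The choice of the largest degree favours large degrees more than proportionally. -/
theorem attachProb_mul_deg_le (hG : IsGood m G) {u v : Fin n} (huv : deg G v < deg G u) :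
    attachProb d G v * deg G u ≤ attachProb d G u * deg G v := by
  classical
  -- Split according to the index `i` of the sample that is chosen: given `x`, each leader has
  -- weight `1 / #leaders`.
  have key : ∀ y, attachProb d G y = ∑ i, ∑ x : Fin d → Fin n,
      if x i = y then sampleProb G x * if i ∈ leaders G x then ((leaders G x).card : ℝ)⁻¹ else 0
      else 0 := by
    intro y
    unfold attachProb
    rw [Finset.sum_comm]
    refine Finset.sum_congr rfl fun x _ => ?_
    have : choiceProb G x y = ∑ i, if x i = y then
        (if i ∈ leaders G x then ((leaders G x).card : ℝ)⁻¹ else 0) else 0 := by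
      unfold choiceProb
      have h2 : (((leaders G x).filter (fun i => x i = y)).card : ℝ) =
          ∑ i, if x i = y then (if i ∈ leaders G x then (1 : ℝ) else 0) else 0 := by
        rw [Finset.card_filter, Nat.cast_sum, ← Finset.sum_filter_add_sum_filter_not
          Finset.univ (fun i => i ∈ leaders G x)]
        rw [Finset.sum_eq_zero (s := Finset.univ.filter (fun i => i ∉ leaders G x)), add_zero]
        · refine Finset.sum_congr (by ext; simp) fun i hi => ?_
          simp only [Finset.mem_filter] at hi
          rw [if_pos hi.2]
          push_cast
          rfl
        · intro i hi
          simp only [Finset.mem_filter] at hi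
          simp [hi.2]
      rw [div_eq_mul_inv]
      trans (∑ i, if x i = y then (if i ∈ leaders G x then (1 : ℝ) else 0) else 0) *
        ((leaders G x).card : ℝ)⁻¹
      · rw [← h2]
      · rw [Finset.sum_mul]
        refine Finset.sum_congr rfl fun i _ => ?_
        split_ifs <;> simp
    rw [this, Finset.mul_sum]
    refine Finset.sum_congr rfl fun i _ => ?_
    split_ifs <;> simp
  rw [key, key, Finset.sum_mul, Finset.sum_mul]
  refine Finset.sum_le_sum fun i _ => ?_
  rw [Finset.sum_mul, Finset.sum_mul]
  -- Exchanging `u` and `v` in coordinate `i` alone pairs samples choosing `u` at `i` with samples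
  -- choosing `v` at `i`; the sample weights are in the ratio of the two degrees.
  let e : (Fin d → Fin n) ≃ (Fin d → Fin n) :=
    Equiv.piCongrRight fun j => if j = i then Equiv.swap u v else Equiv.refl _
  rw [← Equiv.sum_comp e]
  refine Finset.sum_le_sum fun x _ => ?_
  have hei : e x i = Equiv.swap u v (x i) := by simp [e]
  have hej : ∀ j, j ≠ i → e x j = x j := by
    intro j hj
    simp [e, hj]
  by_cases hx : x i = u
  swap
  · have h1 : e x i ≠ v := by
      rw [hei]
      intro h
      apply hx
      exact (Equiv.swap u v).injective (h.trans (Equiv.swap_apply_left u v).symm)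
    simp [hx, h1]
  have hev : e x i = v := by rw [hei, hx, Equiv.swap_apply_left]
  rw [if_pos hev, if_pos hx]
  have hs : sampleProb G (e x) * deg G u = sampleProb G x * deg G v := by
    rw [sampleProb_eq hG, sampleProb_eq hG, ← Finset.mul_prod_erase _ _ (Finset.mem_univ i),
      ← Finset.mul_prod_erase _ _ (Finset.mem_univ i), hev, hx]
    have : ∏ j ∈ Finset.univ.erase i, (deg G (e x j) : ℝ) / (2 * m) =
        ∏ j ∈ Finset.univ.erase i, (deg G (x j) : ℝ) / (2 * m) :=
      Finset.prod_congr rfl fun j hj => by rw [hej j (Finset.ne_of_mem_erase hj)]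
    rw [this]
    ring
  rw [mul_right_comm (sampleProb G (e x)), hs, mul_right_comm (sampleProb G x) _ (deg G v : ℝ)]
  refine mul_le_mul_of_nonneg_left ?_ (mul_nonneg (sampleProb_nonneg x) (Nat.cast_nonneg _))
  -- If `v` leads at index `i`, then `u`, of larger degree, is the unique leader there, so its
  -- tie-breaking weight is 1.
  by_cases hl : i ∈ leaders G (e x)
  · have h1 := mem_leaders.1 hl
    have h2 : leaders G x = {i} := by
      ext j
      rw [Finset.mem_singleton, mem_leaders]
      constructor
      · intro hj
        by_contra hji
        have h3 := h1 j
        have h4 := hj i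
        rw [hej j hji, hev] at h3
        rw [hx] at h4
        omega
      · rintro rfl k
        by_cases hk : k = j
        · rw [hk]
        · have h3 := h1 k
          rw [hej k hk, hev] at h3
          rw [hx]
          omega
    rw [if_pos hl, h2, if_pos (Finset.mem_singleton_self i), Finset.card_singleton]
    rw [Nat.cast_one, inv_one]
    exact inv_le_one_of_one_le₀ (by exact_mod_cast Finset.card_pos.2 ⟨i, hl⟩)
  · rw [if_neg hl]
    split_ifs <;> positivity

end AttachProb

/-! ### Logarithms of counting processes -/

/-- By Tonelli the sum has finite expectation, so it is almost surely finite. -/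
theorem ae_summable_of_sum_integral_le {Ω : Type*} {m0 : MeasurableSpace Ω} {μ : Measure Ω}
    {f : ℕ → Ω → ℝ} (hint : ∀ n, Integrable (f n) μ) (hnn : ∀ᵐ ω ∂μ, ∀ n, 0 ≤ f n ω) {C : ℝ}
    (hC : ∀ n, ∑ k ∈ Finset.range n, ∫ ω, f k ω ∂μ ≤ C) : ∀ᵐ ω ∂μ, Summable fun n => f n ω := by
  have hnn' : ∀ n, 0 ≤ᵐ[μ] f n := fun n => by filter_upwards [hnn] with ω h using h n
  have hm : ∀ n, AEMeasurable (fun ω => ENNReal.ofReal (f n ω)) μ :=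
    fun n => (hint n).aemeasurable.ennreal_ofReal
  have hs : Summable fun n => ∫ ω, f n ω ∂μ :=
    summable_of_sum_range_le (fun n => integral_nonneg_of_ae (hnn' n)) hC
  have h1 : ∫⁻ ω, ∑' n, ENNReal.ofReal (f n ω) ∂μ ≠ ⊤ := by
    rw [lintegral_tsum hm]
    have : ∀ n, ∫⁻ ω, ENNReal.ofReal (f n ω) ∂μ = ENNReal.ofReal (∫ ω, f n ω ∂μ) :=
      fun n => (ofReal_integral_eq_lintegral_ofReal (hint n) (hnn' n)).symm
    simp only [this]
    exact hs.tsum_ofReal_ne_top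
  filter_upwards [ae_lt_top' (AEMeasurable.tsum hm) h1, hnn] with ω h2 h3
  have := ENNReal.summable_toReal h2.ne
  simpa only [ENNReal.toReal_ofReal (h3 _)] using this

/-- The logarithm of an integer process `X` with increments in `{0, 1}`, of conditional mean `p`,
follows its drift `p / X`, up to a convergent error. -/
theorem ae_tendsto_sum_log_sub {Ω : Type*} {m0 : MeasurableSpace Ω} {μ : Measure Ω}
    [IsProbabilityMeasure μ] (F : Filtration ℕ m0) {X : ℕ → Ω → ℕ} {p : ℕ → Ω → ℝ}
    (hint : ∀ n (A : Ω → ℝ), Measurable[F n] A → Integrable A μ)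
    (hXm : ∀ n, Measurable[F n] (X n)) (hpm : ∀ n, Measurable[F n] (p n))
    (hX : ∀ᵐ ω ∂μ, ∀ n, 1 ≤ X n ω ∧ (X (n + 1) ω = X n ω ∨ X (n + 1) ω = X n ω + 1))
    (hp : ∀ᵐ ω ∂μ, ∀ n, 0 ≤ p n ω)
    (hcond : ∀ n (A : Ω → ℝ), Measurable[F n] A →
      ∫ ω, A ω * ((X (n + 1) ω : ℝ) - X n ω) ∂μ = ∫ ω, A ω * p n ω ∂μ) :
    ∀ᵐ ω ∂μ, ∃ l, Tendsto (fun n => ∑ k ∈ Finset.range n,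
      (Real.log (X (k + 1) ω) - Real.log (X k ω) - p k ω / X k ω)) atTop (𝓝 l) := by
  have hmono : ∀ n (A : Ω → ℝ), Measurable[F n] A → Measurable[F (n + 1)] A :=
    fun n A hA => hA.mono (F.mono n.le_succ) le_rfl
  have hXr : ∀ n, Measurable[F n] fun ω => (X n ω : ℝ) :=
    fun n => (measurable_from_top (f := fun k : ℕ => (k : ℝ))).comp (hXm n)
  -- Since the increment `Y` is 0 or 1, the increment of `log X` is exactly `a * Y`, with `a` known
  -- at time `n`.
  let a : ℕ → Ω → ℝ := fun n ω => Real.log (1 + (X n ω : ℝ)⁻¹)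
  let Y : ℕ → Ω → ℝ := fun n ω => (X (n + 1) ω : ℝ) - X n ω
  have ham : ∀ n, Measurable[F n] (a n) := fun n =>
    Real.measurable_log.comp ((measurable_const (a := (1 : ℝ))).add (hXr n).inv)
  have hYm : ∀ n, Measurable[F (n + 1)] (Y n) := fun n => (hXr (n + 1)).sub (hmono n _ (hXr n))
  have hcond0 : ∀ n (A : Ω → ℝ), Measurable[F n] A → ∫ ω, A ω * (Y n ω - p n ω) ∂μ = 0 := by
    intro n A hA
    simp only [mul_sub]
    have h1 : Integrable (fun ω => A ω * Y n ω) μ := hint (n + 1) _ ((hmono n _ hA).mul (hYm n))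
    have h2 : Integrable (fun ω => A ω * p n ω) μ := hint n _ (hA.mul (hpm n))
    rw [integral_sub h1 h2, sub_eq_zero]
    exact hcond n A hA
  have hinv : ∀ n, Integrable (fun ω => (X n ω : ℝ)⁻¹) μ := fun n => hint n _ (hXr n).inv
  -- the series of the conditional variances converges
  have hq : ∀ n, ∫ ω, p n ω / (X n ω : ℝ) ^ 2 ∂μ ≤
      2 * ∫ ω, (X n ω : ℝ)⁻¹ ∂μ - 2 * ∫ ω, (X (n + 1) ω : ℝ)⁻¹ ∂μ := by
    intro n
    -- This is the amount by which `1 / X` decreases at a jump, so testing `hcond` against it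
    -- telescopes. The factor 2 comes from `X + 1 ≤ 2 X`.
    have hA : Measurable[F n] fun ω => ((X n ω : ℝ) * (X n ω + 1))⁻¹ :=
      ((hXr n).mul ((hXr n).add measurable_const)).inv
    have h1 := hcond n _ hA
    have h2 : ∫ ω, ((X n ω : ℝ) * (X n ω + 1))⁻¹ * ((X (n + 1) ω : ℝ) - X n ω) ∂μ =
        ∫ ω, (X n ω : ℝ)⁻¹ ∂μ - ∫ ω, (X (n + 1) ω : ℝ)⁻¹ ∂μ := by
      rw [← integral_sub (hinv n) (hinv (n + 1))]
      refine integral_congr_ae ?_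
      filter_upwards [hX] with ω h
      obtain ⟨h3, h4⟩ := h n
      have h5 : (0 : ℝ) < X n ω := by exact_mod_cast h3
      rcases h4 with h4 | h4 <;> rw [h4]
      · simp
      · push_cast
        field_simp
    rw [← mul_sub, ← h2, h1, ← integral_const_mul]
    refine integral_mono_ae (hint n _ ((hpm n).div ((hXr n).pow_const 2)))
      (hint n _ ((hA.mul (hpm n)).const_mul 2)) ?_
    filter_upwards [hX, hp] with ω h hp
    have h5 : (1 : ℝ) ≤ X n ω := by exact_mod_cast (h n).1
    have h6 := hp n
    show p n ω / (X n ω : ℝ) ^ 2 ≤ 2 * (((X n ω : ℝ) * (X n ω + 1))⁻¹ * p n ω)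
    rw [div_eq_mul_inv, ← mul_assoc, mul_comm (p n ω)]
    refine mul_le_mul_of_nonneg_right ?_ h6
    rw [← div_eq_mul_inv, inv_eq_one_div, div_le_div_iff₀ (by positivity) (by positivity)]
    nlinarith
  have hqsum : ∀ n, ∑ k ∈ Finset.range n, ∫ ω, p k ω / (X k ω : ℝ) ^ 2 ∂μ ≤ 2 := by
    intro n
    have h1 : ∑ k ∈ Finset.range n, ∫ ω, p k ω / (X k ω : ℝ) ^ 2 ∂μ ≤
        2 * ∫ ω, (X 0 ω : ℝ)⁻¹ ∂μ - 2 * ∫ ω, (X n ω : ℝ)⁻¹ ∂μ := by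
      refine (Finset.sum_le_sum fun k _ => hq k).trans ?_
      rw [Finset.sum_range_sub' (fun k => 2 * ∫ ω, (X k ω : ℝ)⁻¹ ∂μ)]
    have h2 : 0 ≤ ∫ ω, (X n ω : ℝ)⁻¹ ∂μ := integral_nonneg fun ω => by positivity
    have h3 : ∫ ω, (X 0 ω : ℝ)⁻¹ ∂μ ≤ 1 := by
      have := integral_mono (hinv 0) (integrable_const (1 : ℝ))
        (fun ω => Nat.cast_inv_le_one (X 0 ω))
      simpa using this
    linarith
  have hqm : ∀ n, Integrable (fun ω => p n ω / (X n ω : ℝ) ^ 2) μ :=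
    fun n => hint n _ ((hpm n).div ((hXr n).pow_const 2))
  have hqae : ∀ᵐ ω ∂μ, Summable fun n => p n ω / (X n ω : ℝ) ^ 2 := by
    refine ae_summable_of_sum_integral_le hqm ?_ hqsum
    filter_upwards [hp] with ω h n
    exact div_nonneg (h n) (by positivity)
  -- the martingale
  let N : ℕ → Ω → ℝ := fun n ω => ∑ k ∈ Finset.range n, a k ω * (Y k ω - p k ω)
  have hξm : ∀ n, Measurable[F (n + 1)] fun ω => a n ω * (Y n ω - p n ω) := fun n =>
    (hmono n _ (ham n)).mul ((hYm n).sub (hmono n _ (hpm n)))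
  have hNm : ∀ n, Measurable[F n] (N n) := by
    intro n
    refine Finset.measurable_fun_sum _ fun k hk => ?_
    exact (hξm k).mono (F.mono (Finset.mem_range.1 hk)) le_rfl
  have hNs : ∀ n ω, N (n + 1) ω = N n ω + a n ω * (Y n ω - p n ω) :=
    fun n ω => Finset.sum_range_succ _ _
  have hmart : Martingale N F μ := by
    refine martingale_of_setIntegral_eq_succ (fun n => (hNm n).stronglyMeasurable)
      (fun n => hint n _ (hNm n)) fun n s hs => ?_
    simp only [hNs]
    rw [integral_add (hint n _ (hNm n)).integrableOn (hint _ _ (hξm n)).integrableOn, left_eq_add,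
      ← integral_indicator (F.le n _ hs)]
    rw [← hcond0 n (s.indicator (a n)) ((ham n).indicator hs)]
    congr 1
    ext ω
    by_cases h : ω ∈ s <;> simp [h]
  have hL2 : ∀ n, ∫ ω, N n ω ^ 2 ∂μ ≤ ∑ k ∈ Finset.range n, ∫ ω, p k ω / (X k ω : ℝ) ^ 2 ∂μ := by
    intro n
    induction n with
    | zero => simp [N]
    | succ n ih =>
      rw [Finset.sum_range_succ]
      have h1 : ∀ ω, N (n + 1) ω ^ 2 = N n ω ^ 2 +
          (2 * N n ω * a n ω * (Y n ω - p n ω) + (a n ω * (Y n ω - p n ω)) ^ 2) := by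
        intro ω
        rw [hNs]
        ring
      have hB : Measurable[F n] fun ω => 2 * N n ω * a n ω := ((hNm n).const_mul 2).mul (ham n)
      have hB' : Integrable (fun ω => 2 * N n ω * a n ω * (Y n ω - p n ω)) μ :=
        hint (n + 1) _ ((hmono n _ hB).mul ((hYm n).sub (hmono n _ (hpm n))))
      have hC : Integrable (fun ω => (a n ω * (Y n ω - p n ω)) ^ 2) μ :=
        hint (n + 1) _ ((hξm n).pow_const 2)
      have hBC : Integrable (fun ω => 2 * N n ω * a n ω * (Y n ω - p n ω) +
          (a n ω * (Y n ω - p n ω)) ^ 2) μ := hB'.add hC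
      simp only [h1]
      rw [integral_add (hint n _ ((hNm n).pow_const 2)) hBC, integral_add hB' hC,
        hcond0 n _ hB, zero_add]
      refine add_le_add ih ?_
      -- As `Y² = Y`, one has `(Y - p)² = (1 - 2p)(Y - p) + (p - p²)`, and the first term averages
      -- to zero.
      have hD : Measurable[F n] fun ω => a n ω ^ 2 * (1 - 2 * p n ω) :=
        ((ham n).pow_const 2).mul (measurable_const.sub ((hpm n).const_mul 2))
      have hD' : Integrable (fun ω => a n ω ^ 2 * (1 - 2 * p n ω) * (Y n ω - p n ω)) μ :=
        hint (n + 1) _ ((hmono n _ hD).mul ((hYm n).sub (hmono n _ (hpm n))))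
      have hE : Integrable (fun ω => a n ω ^ 2 * (p n ω - p n ω ^ 2)) μ :=
        hint n _ (((ham n).pow_const 2).mul ((hpm n).sub ((hpm n).pow_const 2)))
      have h2 : ∫ ω, (a n ω * (Y n ω - p n ω)) ^ 2 ∂μ =
          ∫ ω, a n ω ^ 2 * (p n ω - p n ω ^ 2) ∂μ := by
        rw [← zero_add (∫ ω, a n ω ^ 2 * (p n ω - p n ω ^ 2) ∂μ), ← hcond0 n _ hD,
          ← integral_add hD' hE]
        refine integral_congr_ae ?_
        filter_upwards [hX] with ω h
        have h3 : Y n ω ^ 2 = Y n ω := by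
          rcases (h n).2 with h | h <;> simp [Y, h]
        linear_combination a n ω ^ 2 * h3
      rw [h2]
      refine integral_mono_ae hE (hqm n) ?_
      filter_upwards [hX, hp] with ω h hp
      have h5 : (1 : ℝ) ≤ X n ω := by exact_mod_cast (h n).1
      have h6 : 0 ≤ a n ω := Real.log_nonneg (by simp)
      have h7 : a n ω ≤ (X n ω : ℝ)⁻¹ := by
        have := Real.log_le_sub_one_of_pos (x := 1 + (X n ω : ℝ)⁻¹) (by positivity)
        simp only [a]
        linarith
      have h8 := hp n
      calc a n ω ^ 2 * (p n ω - p n ω ^ 2) ≤ a n ω ^ 2 * p n ω :=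
            mul_le_mul_of_nonneg_left (by nlinarith) (by positivity)
        _ ≤ ((X n ω : ℝ)⁻¹) ^ 2 * p n ω := by gcongr
        _ = p n ω / (X n ω : ℝ) ^ 2 := by rw [inv_pow]; ring
  -- From `|N| ≤ 1 + N²` and the variance bound 2; this makes the martingale convergence theorem
  -- available.
  have hL1 : ∀ n, eLpNorm (N n) 1 μ ≤ (3 : NNReal) := by
    intro n
    have hN := hint n _ (hNm n)
    rw [eLpNorm_one_eq_lintegral_enorm, ← ofReal_integral_norm_eq_lintegral_enorm hN]
    have h1 : ∫ ω, ‖N n ω‖ ∂μ ≤ 3 := by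
      have h2 : ∫ ω, ‖N n ω‖ ∂μ ≤ ∫ ω, (1 + N n ω ^ 2) ∂μ := by
        refine integral_mono hN.norm
          ((integrable_const _).add (hint n _ ((hNm n).pow_const 2))) fun ω => ?_
        show |N n ω| ≤ 1 + N n ω ^ 2
        rw [← sq_abs]
        nlinarith [sq_nonneg (|N n ω| - 1), abs_nonneg (N n ω)]
      rw [integral_add (integrable_const _) (hint n _ ((hNm n).pow_const 2))] at h2
      have := hL2 n
      have := hqsum n
      simp only [integral_const, probReal_univ, smul_eq_mul, mul_one] at h2
      linarith
    exact (ENNReal.ofReal_le_ofReal h1).trans (by simp)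
  filter_upwards [hmart.submartingale.exists_ae_tendsto_of_bdd hL1, hqae, hX, hp]
    with ω ⟨c, hc⟩ hs hX hp
  -- The compensator has `p * log (1 + 1/X)` instead of `p / X`; the difference is at most `p / X²`,
  -- which is summable.
  have hs2 : Summable fun n => p n ω * ((X n ω : ℝ)⁻¹ - a n ω) := by
    have hb : ∀ n, 0 ≤ (X n ω : ℝ)⁻¹ - a n ω ∧
        (X n ω : ℝ)⁻¹ - a n ω ≤ ((X n ω : ℝ) ^ 2)⁻¹ := by
      intro n
      have h5 : (1 : ℝ) ≤ X n ω := by exact_mod_cast (hX n).1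
      have h7 := Real.log_le_sub_one_of_pos (x := 1 + (X n ω : ℝ)⁻¹) (by positivity)
      have h8 := Real.one_sub_inv_le_log_of_pos (x := 1 + (X n ω : ℝ)⁻¹) (by positivity)
      refine ⟨by simp only [a]; linarith, ?_⟩
      have h9 : (X n ω : ℝ)⁻¹ - ((X n ω : ℝ) ^ 2)⁻¹ ≤ 1 - (1 + (X n ω : ℝ)⁻¹)⁻¹ := by
        have : 1 - (1 + (X n ω : ℝ)⁻¹)⁻¹ = ((X n ω : ℝ) + 1)⁻¹ := by field_simp; ring
        rw [this]
        have : (X n ω : ℝ)⁻¹ - ((X n ω : ℝ) ^ 2)⁻¹ = ((X n ω : ℝ) - 1) / (X n ω : ℝ) ^ 2 := by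
          field_simp
        rw [this, inv_eq_one_div, div_le_div_iff₀ (by positivity) (by positivity)]
        nlinarith
      simp only [a]
      linarith
    refine Summable.of_nonneg_of_le (fun n => mul_nonneg (hp n) (hb n).1) (fun n => ?_) hs
    rw [div_eq_mul_inv]
    exact mul_le_mul_of_nonneg_left (hb n).2 (hp n)
  refine ⟨c - ∑' n, p n ω * ((X n ω : ℝ)⁻¹ - a n ω), ?_⟩
  refine (hc.sub hs2.hasSum.tendsto_sum_nat).congr fun n => ?_
  simp only [N]
  rw [← Finset.sum_sub_distrib]
  refine Finset.sum_congr rfl fun k _ => ?_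
  have h5 : (1 : ℝ) ≤ X k ω := by exact_mod_cast (hX k).1
  have h6 : Real.log (X (k + 1) ω) - Real.log (X k ω) = a k ω * Y k ω := by
    simp only [Y, a]
    rcases (hX k).2 with h | h <;> rw [h]
    · simp
    · push_cast
      rw [← Real.log_div (by positivity) (by positivity)]
      have : ((X k ω : ℝ) + 1) / X k ω = 1 + (X k ω : ℝ)⁻¹ := by field_simp
      rw [this]
      ring
  rw [h6]
  ring

/-! ### Sequences with a drift -/

/-- Below `a` the drift `c * w` has infinite total and the noise `δ` a convergent sum, so `ℓ` must
reach `a`. Afterwards a crossing step leaves it at least at `a - ε`, and until it returns above `a`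
only the small oscillation of the noise can lower it. -/
theorem eventually_gt_of_drift {ℓ w δ : ℕ → ℝ} {a b c s : ℝ} (hc : 0 ≤ c)
    (hw : Tendsto (fun n => c * ∑ k ∈ Finset.range n, w k) atTop atTop)
    (hw0 : ∀ᶠ n in atTop, 0 ≤ w n)
    (hδ : Tendsto (fun n => ∑ k ∈ Finset.range n, δ k) atTop (𝓝 s))
    (hlow : ∀ᶠ n in atTop, ℓ n ≤ a → ℓ n + c * w n + δ n ≤ ℓ (n + 1))
    (hjump : ∀ ε > 0, ∀ᶠ n in atTop, a ≤ ℓ n → a - ε ≤ ℓ (n + 1)) (hb : b < a) :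
    ∀ᶠ n in atTop, b < ℓ n := by
  -- One `ε` for the crossing step, two for the difference of two partial sums of the noise.
  obtain ⟨ε, hε, hε'⟩ : ∃ ε > 0, a - 3 * ε = b := ⟨(a - b) / 3, by linarith, by ring⟩
  obtain ⟨N, hN⟩ := eventually_atTop.1 (((hw0.and hlow).and (hjump ε hε)).and
    (Metric.tendsto_nhds.1 hδ ε hε))
  set D : ℕ → ℝ := fun n => ∑ k ∈ Finset.range n, δ k with hD
  have hDs : ∀ n, D (n + 1) = D n + δ n := fun n => Finset.sum_range_succ _ _
  have hDd : ∀ n ≥ N, |D n - s| < ε := fun n hn => (hN n hn).2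
  obtain ⟨N', hN', hhit⟩ : ∃ N' ≥ N, a ≤ ℓ N' := by
    by_contra! hcon
    have h1 : ∀ n ≥ N, ℓ N + c * (∑ k ∈ Finset.range n, w k - ∑ k ∈ Finset.range N, w k) +
        (D n - D N) ≤ ℓ n := by
      intro n hn
      induction n, hn using Nat.le_induction with
      | base => simp
      | succ n hn ih =>
        have h2 := (hN n hn).1.1.2 (hcon n hn).le
        rw [Finset.sum_range_succ, hDs]
        linarith
    obtain ⟨n, hn, hn'⟩ := ((eventually_ge_atTop N).and (hw.eventually_gt_atTop
      (a - ℓ N + c * ∑ k ∈ Finset.range N, w k + 2 * ε))).exists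
    have h2 := h1 n hn
    have h3 := hcon n hn
    have h4 := abs_lt.1 (hDd n hn)
    have h5 := abs_lt.1 (hDd N le_rfl)
    linarith
  -- Here `m` is `N'` or the time just after the last visit above `a`.
  have hinv : ∀ n ≥ N', ∃ m ≥ N, a - ε + (D n - D m) ≤ ℓ n := by
    intro n hn
    induction n, hn using Nat.le_induction with
    | base => exact ⟨N', hN', by linarith⟩
    | succ n hn ih =>
      have hnN := hN'.le.trans hn
      rcases le_total a (ℓ n) with h | h
      · have := (hN n hnN).1.2 h
        exact ⟨n + 1, hnN.trans n.le_succ, by linarith⟩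
      · obtain ⟨m, hm, h1⟩ := ih
        have h2 := (hN n hnN).1.1.2 h
        have h3 := mul_nonneg hc (hN n hnN).1.1.1
        exact ⟨m, hm, by rw [hDs]; linarith⟩
  filter_upwards [eventually_ge_atTop N'] with n hn
  obtain ⟨m, hm, h1⟩ := hinv n hn
  have h4 := abs_lt.1 (hDd n (hN'.le.trans hn))
  have h5 := abs_lt.1 (hDd m hm)
  linarith

/-- The terms are at most `b n - b (n + 1)`, which telescopes. This allows `1 / n` and `1 / (n log
n)` to be exchanged with the increments of `log n` and `log (log n)`. -/
theorem summable_sub_of_interlaced {b w : ℕ → ℝ} {N : ℕ} (hb : ∀ n, 0 ≤ b n)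
    (h : ∀ n ≥ N, b (n + 1) ≤ w n ∧ w n ≤ b n) : Summable fun n => b n - w n := by
  rw [← summable_nat_add_iff N]
  refine summable_of_sum_range_le (c := b N) (fun n => ?_) fun n => ?_
  · have := (h (n + N) (by omega)).2
    linarith
  · have h1 : ∀ n, ∑ k ∈ Finset.range n, (b (k + N) - w (k + N)) ≤ b N - b (n + N) := by
      intro n
      induction n with
      | zero => simp
      | succ n ih =>
        rw [Finset.sum_range_succ]
        have := (h (n + N) (by omega)).1
        rw [show n + 1 + N = n + N + 1 by ring]
        linarith
    have := hb (n + N)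
    linarith [h1 n]

theorem log_succ_sub_log_bounds {n : ℕ} (hn : 1 ≤ n) :
    1 / ((n + 1 : ℕ) : ℝ) ≤ Real.log (n + 1 : ℕ) - Real.log n ∧
      Real.log (n + 1 : ℕ) - Real.log n ≤ 1 / (n : ℝ) := by
  have h0 : (0 : ℝ) < n := by exact_mod_cast hn
  rw [← Real.log_div (by positivity) (by positivity)]
  have h1 := Real.log_le_sub_one_of_pos (x := ((n + 1 : ℕ) : ℝ) / n) (by positivity)
  have h2 := Real.one_sub_inv_le_log_of_pos (x := ((n + 1 : ℕ) : ℝ) / n) (by positivity)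
  push_cast at *
  constructor
  · refine le_trans (le_of_eq ?_) h2
    field_simp
    ring
  · refine h1.trans (le_of_eq ?_)
    field_simp
    ring

theorem log_log_succ_sub_bounds {n : ℕ} (hn : 2 ≤ n) :
    1 / (((n + 1 : ℕ) : ℝ) * Real.log (n + 1 : ℕ)) ≤
        Real.log (Real.log (n + 1 : ℕ)) - Real.log (Real.log n) ∧
      Real.log (Real.log (n + 1 : ℕ)) - Real.log (Real.log n) ≤ 1 / ((n : ℝ) * Real.log n) := by
  have h0 : (1 : ℝ) < n := by exact_mod_cast hn
  have h0' : (1 : ℝ) < (n + 1 : ℕ) := by exact_mod_cast (by omega : 1 < n + 1)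
  have hl := Real.log_pos h0
  have hl' := Real.log_pos h0'
  obtain ⟨h1, h2⟩ := log_succ_sub_log_bounds (n := n) (by omega)
  rw [← Real.log_div hl'.ne' hl.ne']
  have h3 := Real.log_le_sub_one_of_pos (div_pos hl' hl)
  have h4 := Real.one_sub_inv_le_log_of_pos (div_pos hl' hl)
  constructor
  · refine le_trans ?_ h4
    rw [inv_div, one_sub_div hl'.ne', ← div_div]
    gcongr
  · refine h3.trans ?_
    rw [div_sub_one hl.ne', ← div_div]
    gcongr

/-- Half the geometric sum of `1 - x / 2`: the growth rate of a degree `n * x`, relative to it. -/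
def rate (d : ℕ) (x : ℝ) : ℝ := (∑ i ∈ Finset.range d, (1 - x / 2) ^ i) / 2

theorem mul_rate (d : ℕ) (x : ℝ) : x * rate d x = 1 - (1 - x / 2) ^ d := by
  have := mul_neg_geom_sum (1 - x / 2) d
  rw [← this, rate]
  ring

theorem rate_anti {d : ℕ} {x y : ℝ} (hxy : x ≤ y) (hy : y ≤ 2) : rate d y ≤ rate d x := by
  unfold rate
  gcongr
  linarith

theorem rate_strictAnti {d : ℕ} (hd : 2 ≤ d) {x y : ℝ} (hxy : x < y) (hy : y ≤ 2) :
    rate d y < rate d x := by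
  unfold rate
  refine div_lt_div_of_pos_right ?_ two_pos
  -- The linear term, present because `d ≥ 2`, is strictly decreasing.
  refine Finset.sum_lt_sum (fun i _ => by gcongr; linarith) ⟨1, Finset.mem_range.2 hd, ?_⟩
  simpa only [pow_one] using (by linarith : 1 - y / 2 < 1 - x / 2)

/-- `X` is eventually a counting sequence with `1 ≤ X n ≤ n`, and its logarithm follows `p / X` up
to a convergent error. -/
structure IsDriven (X : ℕ → ℕ) (p : ℕ → ℝ) : Prop where
  one_le : ∀ᶠ n in atTop, 1 ≤ X n
  le_self : ∀ᶠ n in atTop, X n ≤ n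
  step : ∀ᶠ n in atTop, X (n + 1) = X n ∨ X (n + 1) = X n + 1
  conv : ∃ l, Tendsto (fun n => ∑ k ∈ Finset.range n,
    (Real.log (X (k + 1)) - Real.log (X k) - p k / X k)) atTop (𝓝 l)

/-! ### Asymptotic bounds for driven counting sequences -/

namespace IsDriven

variable {X : ℕ → ℕ} {p : ℕ → ℝ} {d : ℕ} {A B : ℝ}

theorem tendsto_sum_log :
    Tendsto (fun n => ∑ k ∈ Finset.range n, (Real.log (k + 1 : ℕ) - Real.log (k : ℕ)))
      atTop atTop := by
  have h : ∀ n, ∑ k ∈ Finset.range n, (Real.log (k + 1 : ℕ) - Real.log (k : ℕ)) =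
      Real.log n := by
    intro n
    rw [Finset.sum_range_sub (fun k : ℕ => Real.log (k : ℕ))]
    simp
  simp only [h]
  exact Real.tendsto_log_atTop.comp tendsto_natCast_atTop_atTop

theorem tendsto_sum_log_log :
    Tendsto (fun n => ∑ k ∈ Finset.range n,
      (Real.log (Real.log (k + 1 : ℕ)) - Real.log (Real.log (k : ℕ)))) atTop atTop := by
  have h : ∀ n, ∑ k ∈ Finset.range n,
      (Real.log (Real.log (k + 1 : ℕ)) - Real.log (Real.log (k : ℕ))) =
      Real.log (Real.log n) := by
    intro n
    rw [Finset.sum_range_sub (fun k : ℕ => Real.log (Real.log (k : ℕ)))]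
    -- The convention `log 0 = 0` makes the initial term of the telescoped sum vanish.
    simp
  simp only [h]
  exact Real.tendsto_log_atTop.comp
    (Real.tendsto_log_atTop.comp tendsto_natCast_atTop_atTop)

theorem summable_inv_sub_log :
    Summable fun n : ℕ => 1 / (n : ℝ) - (Real.log (n + 1 : ℕ) - Real.log (n : ℕ)) :=
  summable_sub_of_interlaced (N := 1) (fun n => by positivity)
    fun _ hn => log_succ_sub_log_bounds hn

theorem summable_inv_sub_log_log :
    Summable fun n : ℕ => 1 / ((n : ℝ) * Real.log n) -
      (Real.log (Real.log (n + 1 : ℕ)) - Real.log (Real.log (n : ℕ))) :=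
  summable_sub_of_interlaced (b := fun n : ℕ => 1 / ((n : ℝ) * Real.log n)) (N := 2)
    (fun n => by
      have := Real.log_natCast_nonneg n
      positivity)
    fun _ hn => log_log_succ_sub_bounds hn

theorem mono (h : IsDriven X p) : ∀ᶠ n in atTop, X n ≤ X (n + 1) := by
  filter_upwards [h.step] with n hn
  omega

/-- While `X / n ≤ A`, the drift of `log X` is at least `rate d A / n`, hence at least `rate d A`
times the increment of `log n`. As `rate d A > 1`, `log (X / n)` is pushed up. -/
theorem eventually_lt_div (h : IsDriven X p)
    (hp : ∀ᶠ n in atTop, 1 - (1 - (X n : ℝ) / (2 * n)) ^ d ≤ p n) (hA0 : 0 < A) (hA2 : A ≤ 2)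
    (hA : 1 < rate d A) (hB : B < A) : ∀ᶠ n : ℕ in atTop, B < X n / n := by
  rcases le_or_gt B 0 with hB0 | hB0
  · filter_upwards [h.one_le, eventually_ge_atTop 1] with n h1 h2
    have : (0 : ℝ) < X n := by exact_mod_cast h1
    have : (0 : ℝ) < n := by exact_mod_cast h2
    exact hB0.trans_lt (by positivity)
  obtain ⟨s, hs⟩ := h.conv
  have key := eventually_gt_of_drift (ℓ := fun n => Real.log (X n / n)) (a := Real.log A)
    (b := Real.log B) (c := rate d A - 1) (by linarith)
    (tendsto_sum_log.const_mul_atTop (by linarith)) ?_ hs ?_ ?_ (Real.log_lt_log hB0 hB)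
  · filter_upwards [key, h.one_le, eventually_ge_atTop 1] with n hn h1 h2
    have : (0 : ℝ) < X n := by exact_mod_cast h1
    have : (0 : ℝ) < n := by exact_mod_cast h2
    exact (Real.log_lt_log_iff hB0 (by positivity)).1 hn
  · filter_upwards [eventually_ge_atTop 1] with n hn
    exact le_trans (by positivity) (log_succ_sub_log_bounds hn).1
  · filter_upwards [hp, h.one_le, h.step, eventually_ge_atTop 1] with n hp h1 hstep hn hℓ
    have hx : (0 : ℝ) < X n := by exact_mod_cast h1
    have hn' : (0 : ℝ) < n := by exact_mod_cast hn
    have hx' : (0 : ℝ) < X (n + 1) := by exact_mod_cast (by omega : 0 < X (n + 1))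
    have h2 := log_succ_sub_log_bounds hn
    have h3 : (X n : ℝ) / n ≤ A := (Real.log_le_log_iff (by positivity) hA0).1 hℓ
    have h4 : rate d A * (1 / n) ≤ p n / X n := by
      rw [le_div_iff₀ hx]
      refine le_trans ?_ hp
      have h5 := mul_rate d ((X n : ℝ) / n)
      rw [div_div, mul_comm (n : ℝ)] at h5
      rw [← h5]
      have h6 := rate_anti (d := d) h3 hA2
      calc rate d A * (1 / n) * X n = X n / n * rate d A := by ring
        _ ≤ _ := by gcongr
    show Real.log (X n / n) + _ + _ ≤ Real.log (X (n + 1) / (n + 1 : ℕ))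
    rw [Real.log_div hx.ne' hn'.ne', Real.log_div hx'.ne' (by positivity)]
    have h7 := mul_le_mul_of_nonneg_left h2.2 (by linarith : 0 ≤ rate d A)
    linarith
  · intro ε hε
    have h1 : ∀ᶠ n : ℕ in atTop, 1 / (n : ℝ) < ε :=
      tendsto_one_div_atTop_nhds_zero_nat.eventually_lt_const hε
    filter_upwards [h1, h.one_le, h.mono, eventually_ge_atTop 1] with n h1 h3 h4 hn hℓ
    have hx : (0 : ℝ) < X n := by exact_mod_cast h3
    have hn' : (0 : ℝ) < n := by exact_mod_cast hn
    have hx' : (X n : ℝ) ≤ X (n + 1) := by exact_mod_cast h4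
    have h2 := log_succ_sub_log_bounds hn
    have h5 := Real.log_le_log hx hx'
    show _ ≤ Real.log (X (n + 1) / (n + 1 : ℕ))
    rw [Real.log_div hx.ne' hn'.ne'] at hℓ
    rw [Real.log_div (by linarith) (by positivity)]
    linarith

/-- Same argument for `-log (X / n)`, pushed up while `X / n ≥ A`. -/
theorem eventually_div_lt (h : IsDriven X p)
    (hp : ∀ᶠ n in atTop, p n ≤ 1 - (1 - (X n : ℝ) / (2 * n)) ^ d) (hA0 : 0 < A)
    (hA : rate d A < 1) (hB : A < B) : ∀ᶠ n : ℕ in atTop, X n / n < B := by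
  obtain ⟨s, hs⟩ := h.conv
  -- The increment of `log n` lies below `1 / n`, the wrong side here; the summable discrepancy is
  -- put into the noise.
  have hs' := hs.neg.sub (summable_inv_sub_log.hasSum.tendsto_sum_nat.const_mul (rate d A))
  simp only [Finset.mul_sum, ← Finset.sum_neg_distrib, ← Finset.sum_sub_distrib] at hs'
  have key := eventually_gt_of_drift (ℓ := fun n => -Real.log (X n / n)) (a := -Real.log A)
    (b := -Real.log B) (c := 1 - rate d A) (by linarith)
    (tendsto_sum_log.const_mul_atTop (by linarith)) ?_ hs' ?_ ?_
    (neg_lt_neg (Real.log_lt_log hA0 hB))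
  · filter_upwards [key, h.one_le, eventually_ge_atTop 1] with n hn h1 h2
    have : (0 : ℝ) < X n := by exact_mod_cast h1
    have : (0 : ℝ) < n := by exact_mod_cast h2
    exact (Real.log_lt_log_iff (by positivity) (by linarith)).1 (neg_lt_neg_iff.1 hn)
  · filter_upwards [eventually_ge_atTop 1] with n hn
    exact le_trans (by positivity) (log_succ_sub_log_bounds hn).1
  · filter_upwards [hp, h.one_le, h.step, h.le_self, eventually_ge_atTop 1]
      with n hp h1 hstep hle hn hℓ
    have hx : (0 : ℝ) < X n := by exact_mod_cast h1
    have hn' : (0 : ℝ) < n := by exact_mod_cast hn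
    have hx' : (0 : ℝ) < X (n + 1) := by exact_mod_cast (by omega : 0 < X (n + 1))
    have hxn : (X n : ℝ) ≤ n := by exact_mod_cast hle
    have h3 : A ≤ (X n : ℝ) / n :=
      (Real.log_le_log_iff hA0 (by positivity)).1 (neg_le_neg_iff.1 hℓ)
    have h4 : p n / X n ≤ rate d A * (1 / n) := by
      rw [div_le_iff₀ hx]
      refine hp.trans ?_
      have h5 := mul_rate d ((X n : ℝ) / n)
      rw [div_div, mul_comm (n : ℝ)] at h5
      rw [← h5]
      have h6 := rate_anti (d := d) h3 (((div_le_one hn').2 hxn).trans one_le_two)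
      calc X n / n * rate d (X n / n) ≤ X n / n * rate d A := by gcongr
        _ = rate d A * (1 / n) * X n := by ring
    show -Real.log (X n / n) + _ + _ ≤ -Real.log (X (n + 1) / (n + 1 : ℕ))
    rw [Real.log_div hx.ne' hn'.ne', Real.log_div hx'.ne' (by positivity)]
    linarith
  · intro ε hε
    have h1 : Tendsto (fun n : ℕ => -Real.log (A + 1 / (n : ℝ))) atTop (𝓝 (-Real.log A)) := by
      have h2 : Tendsto (fun n : ℕ => A + 1 / (n : ℝ)) atTop (𝓝 (A + 0)) :=
        tendsto_one_div_atTop_nhds_zero_nat.const_add A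
      rw [add_zero] at h2
      exact (h2.log hA0.ne').neg
    filter_upwards [h1.eventually_const_lt (sub_lt_self _ hε), h.one_le, h.step,
      eventually_ge_atTop 1] with n h1 h3 h4 hn hℓ
    have hx : (0 : ℝ) < X n := by exact_mod_cast h3
    have hn' : (0 : ℝ) < n := by exact_mod_cast hn
    have hx' : (0 : ℝ) < X (n + 1) := by exact_mod_cast (by omega : 0 < X (n + 1))
    have h5 : (X n : ℝ) / n ≤ A :=
      (Real.log_le_log_iff (by positivity) hA0).1 (neg_le_neg_iff.1 hℓ)
    refine h1.le.trans (neg_le_neg (Real.log_le_log (by positivity) ?_))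
    have h6 : (X (n + 1) : ℝ) ≤ X n + 1 := by exact_mod_cast (by omega : X (n + 1) ≤ X n + 1)
    calc (X (n + 1) : ℝ) / (n + 1 : ℕ) ≤ (X n + 1) / n := by
          gcongr
          exact n.le_succ
      _ = X n / n + 1 / n := add_div _ _ _
      _ ≤ A + 1 / n := by gcongr

/-- For two choices `p / X ≥ 1 / n - X / (4n²)`. Below level `A` the loss is at most `A / 4` times
`1 / (n log n)`, while the factor `log n` gains the increment of `log (log n)`; the balance is
positive for `A < 4`. -/
theorem eventually_lt_mul_log_div (h : IsDriven X p)
    (hp : ∀ᶠ n in atTop, 1 - (1 - (X n : ℝ) / (2 * n)) ^ 2 ≤ p n) (hA0 : 0 < A)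
    (hA : A < 4) (hB : B < A) : ∀ᶠ n : ℕ in atTop, B < X n * Real.log n / n := by
  rcases le_or_gt B 0 with hB0 | hB0
  · filter_upwards [h.one_le, eventually_ge_atTop 2] with n h1 h2
    have : (0 : ℝ) < X n := by exact_mod_cast h1
    have h3 : (1 : ℝ) < n := by exact_mod_cast h2
    have := Real.log_pos h3
    exact hB0.trans_lt (by positivity)
  obtain ⟨s, hs⟩ := h.conv
  -- Compensates for replacing `1 / (n log n)` by the increment of `log (log n)` in the loss term.
  have hs' := hs.sub (summable_inv_sub_log_log.hasSum.tendsto_sum_nat.const_mul (A / 4))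
  simp only [Finset.mul_sum, ← Finset.sum_sub_distrib] at hs'
  have key := eventually_gt_of_drift (ℓ := fun n => Real.log (X n * Real.log n / n))
    (a := Real.log A) (b := Real.log B) (c := 1 - A / 4) (by linarith)
    (tendsto_sum_log_log.const_mul_atTop (by linarith)) ?_ hs' ?_ ?_ (Real.log_lt_log hB0 hB)
  · filter_upwards [key, h.one_le, eventually_ge_atTop 2] with n hn h1 h2
    have : (0 : ℝ) < X n := by exact_mod_cast h1
    have h3 : (1 : ℝ) < n := by exact_mod_cast h2
    have := Real.log_pos h3
    exact (Real.log_lt_log_iff hB0 (by positivity)).1 hn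
  · filter_upwards [eventually_ge_atTop 2] with n hn
    refine le_trans ?_ (log_log_succ_sub_bounds hn).1
    have := Real.log_natCast_nonneg (n + 1)
    positivity
  · filter_upwards [hp, h.one_le, h.step, eventually_ge_atTop 2] with n hp h1 hstep hn hℓ
    have hx : (0 : ℝ) < X n := by exact_mod_cast h1
    have hn1 : (1 : ℝ) < n := by exact_mod_cast hn
    have hn' : (0 : ℝ) < n := by linarith
    have hx' : (0 : ℝ) < X (n + 1) := by exact_mod_cast (by omega : 0 < X (n + 1))
    have hl := Real.log_pos hn1
    have hl' : 0 < Real.log (n + 1 : ℕ) := Real.log_pos (by exact_mod_cast (by omega : 1 < n + 1))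
    have h2 := log_succ_sub_log_bounds (n := n) (by omega)
    have h2' := log_log_succ_sub_bounds hn
    have h3 : (X n : ℝ) * Real.log n / n ≤ A := (Real.log_le_log_iff (by positivity) hA0).1 hℓ
    have h4 : 1 / n - A / 4 * (1 / (n * Real.log n)) ≤ p n / X n := by
      rw [le_div_iff₀ hx]
      refine le_trans ?_ hp
      have h5 : (X n : ℝ) / n ≤ A / Real.log n := by
        rw [le_div_iff₀ hl]
        refine le_trans (le_of_eq ?_) h3
        ring
      calc (1 / (n : ℝ) - A / 4 * (1 / (n * Real.log n))) * X n
          = X n / n - X n / (4 * n) * (A / Real.log n) := by field_simp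
        _ ≤ X n / n - X n / (4 * n) * (X n / n) := by gcongr
        _ = _ := by field_simp; ring
    show Real.log (X n * Real.log n / n) + _ + _ ≤
      Real.log (X (n + 1) * Real.log (n + 1 : ℕ) / (n + 1 : ℕ))
    rw [Real.log_div (by positivity) hn'.ne', Real.log_div (by positivity) (by positivity),
      Real.log_mul hx.ne' hl.ne', Real.log_mul hx'.ne' hl'.ne']
    linarith
  · intro ε hε
    have h1 : ∀ᶠ n : ℕ in atTop, 1 / (n : ℝ) < ε :=
      tendsto_one_div_atTop_nhds_zero_nat.eventually_lt_const hε
    filter_upwards [h1, h.one_le, h.mono, eventually_ge_atTop 2] with n h1 h3 h4 hn hℓ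
    have hx : (0 : ℝ) < X n := by exact_mod_cast h3
    have hn1 : (1 : ℝ) < n := by exact_mod_cast hn
    have hn' : (0 : ℝ) < n := by linarith
    have hl := Real.log_pos hn1
    have hl' : 0 < Real.log (n + 1 : ℕ) := Real.log_pos (by exact_mod_cast (by omega : 1 < n + 1))
    have hx' : (X n : ℝ) ≤ X (n + 1) := by exact_mod_cast h4
    have h2 := log_succ_sub_log_bounds (n := n) (by omega)
    have h2' := (log_log_succ_sub_bounds hn).1
    have h6 : 0 ≤ 1 / (((n + 1 : ℕ) : ℝ) * Real.log (n + 1 : ℕ)) := by positivity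
    have h5 := Real.log_le_log hx hx'
    show _ ≤ Real.log (X (n + 1) * Real.log (n + 1 : ℕ) / (n + 1 : ℕ))
    rw [Real.log_div (by positivity) hn'.ne', Real.log_mul hx.ne' hl.ne'] at hℓ
    have hx0 : (X (n + 1) : ℝ) ≠ 0 := by linarith
    rw [Real.log_div (mul_ne_zero hx0 hl'.ne') (by positivity), Real.log_mul hx0 hl'.ne']
    linarith

theorem eventually_mul_log_div_lt (h : IsDriven X p)
    (hp : ∀ᶠ n in atTop, p n ≤ 1 - (1 - (X n : ℝ) / (2 * n)) ^ 2)
    (hA : 4 < A) (hB : A < B) : ∀ᶠ n : ℕ in atTop, X n * Real.log n / n < B := by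
  have hA0 : 0 < A := by linarith
  obtain ⟨s, hs⟩ := h.conv
  -- For the upper bound it is `1 / n` that must be replaced by the increment of `log n`; the `log
  -- (log n)` comparison already has the right sign.
  have hs' := hs.neg.sub summable_inv_sub_log.hasSum.tendsto_sum_nat
  simp only [← Finset.sum_neg_distrib, ← Finset.sum_sub_distrib] at hs'
  have key := eventually_gt_of_drift (ℓ := fun n => -Real.log (X n * Real.log n / n))
    (a := -Real.log A) (b := -Real.log B) (c := A / 4 - 1) (by linarith)
    (tendsto_sum_log_log.const_mul_atTop (by linarith)) ?_ hs' ?_ ?_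
    (neg_lt_neg (Real.log_lt_log hA0 hB))
  · filter_upwards [key, h.one_le, eventually_ge_atTop 2] with n hn h1 h2
    have : (0 : ℝ) < X n := by exact_mod_cast h1
    have h3 : (1 : ℝ) < n := by exact_mod_cast h2
    have := Real.log_pos h3
    exact (Real.log_lt_log_iff (by positivity) (by linarith)).1 (neg_lt_neg_iff.1 hn)
  · filter_upwards [eventually_ge_atTop 2] with n hn
    refine le_trans ?_ (log_log_succ_sub_bounds hn).1
    have := Real.log_natCast_nonneg (n + 1)
    positivity
  · filter_upwards [hp, h.one_le, h.step, eventually_ge_atTop 2] with n hp h1 hstep hn hℓ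
    have hx : (0 : ℝ) < X n := by exact_mod_cast h1
    have hn1 : (1 : ℝ) < n := by exact_mod_cast hn
    have hn' : (0 : ℝ) < n := by linarith
    have hx' : (0 : ℝ) < X (n + 1) := by exact_mod_cast (by omega : 0 < X (n + 1))
    have hl := Real.log_pos hn1
    have hl' : 0 < Real.log (n + 1 : ℕ) := Real.log_pos (by exact_mod_cast (by omega : 1 < n + 1))
    have h2' := mul_le_mul_of_nonneg_left (log_log_succ_sub_bounds hn).2
      (by linarith : 0 ≤ A / 4)
    have h3 : A ≤ (X n : ℝ) * Real.log n / n :=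
      (Real.log_le_log_iff hA0 (by positivity)).1 (neg_le_neg_iff.1 hℓ)
    have h4 : p n / X n ≤ 1 / n - A / 4 * (1 / (n * Real.log n)) := by
      rw [div_le_iff₀ hx]
      refine hp.trans ?_
      have h5 : A / Real.log n ≤ (X n : ℝ) / n := by
        rw [div_le_iff₀ hl]
        refine h3.trans (le_of_eq ?_)
        ring
      calc _ = (X n : ℝ) / n - X n / (4 * n) * (X n / n) := by field_simp; ring
        _ ≤ (X n : ℝ) / n - X n / (4 * n) * (A / Real.log n) := by gcongr
        _ = (1 / (n : ℝ) - A / 4 * (1 / (n * Real.log n))) * X n := by field_simp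
    show -Real.log (X n * Real.log n / n) + _ + _ ≤
      -Real.log (X (n + 1) * Real.log (n + 1 : ℕ) / (n + 1 : ℕ))
    rw [Real.log_div (by positivity) hn'.ne', Real.log_div (by positivity) (by positivity),
      Real.log_mul hx.ne' hl.ne', Real.log_mul hx'.ne' hl'.ne']
    linarith
  · intro ε hε
    have hld : Tendsto (fun n : ℕ => Real.log n / n) atTop (𝓝 0) := by
      have := Real.isLittleO_log_id_atTop.tendsto_div_nhds_zero.comp
        (tendsto_natCast_atTop_atTop (R := ℝ))
      exact this
    have hld1 := (tendsto_add_atTop_iff_nat 1).2 hld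
    have h1 : Tendsto (fun n : ℕ => -Real.log (A + Real.log (n : ℝ) / n)) atTop
        (𝓝 (-Real.log A)) := by
      have h2 := hld.const_add A
      rw [add_zero] at h2
      exact (h2.log hA0.ne').neg
    filter_upwards [h1.eventually_const_lt (sub_lt_self _ hε), h.one_le, h.step,
      eventually_ge_atTop 3] with n h1 h3 h4 hn hℓ
    have hx : (0 : ℝ) < X n := by exact_mod_cast h3
    have hn1 : (3 : ℝ) ≤ n := by exact_mod_cast hn
    have hn' : (0 : ℝ) < n := by linarith
    have hx' : (0 : ℝ) < X (n + 1) := by exact_mod_cast (by omega : 0 < X (n + 1))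
    have hl : 0 < Real.log n := Real.log_pos (by linarith)
    have hl' : 0 < Real.log (n + 1 : ℕ) := Real.log_pos (by exact_mod_cast (by omega : 1 < n + 1))
    have h5 : (X n : ℝ) * Real.log n / n ≤ A :=
      (Real.log_le_log_iff (by positivity) hA0).1 (neg_le_neg_iff.1 hℓ)
    refine h1.le.trans (neg_le_neg (Real.log_le_log (by positivity) ?_))
    have h6 : (X (n + 1) : ℝ) ≤ X n + 1 := by exact_mod_cast (by omega : X (n + 1) ≤ X n + 1)
    -- `log x / x` decreases from `e` on, hence the restriction to `n ≥ 3`.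
    have h7 : Real.log (n + 1 : ℕ) / (n + 1 : ℕ) ≤ Real.log n / n := by
      have he : Real.exp 1 ≤ 3 := Real.exp_one_lt_three.le
      have hns : (n : ℝ) ≤ (n + 1 : ℕ) := by exact_mod_cast n.le_succ
      exact Real.log_div_self_antitoneOn (he.trans hn1) ((he.trans hn1).trans hns) hns
    calc (X (n + 1) : ℝ) * Real.log (n + 1 : ℕ) / (n + 1 : ℕ)
        = X (n + 1) * (Real.log (n + 1 : ℕ) / (n + 1 : ℕ)) := mul_div_assoc _ _ _
      _ ≤ (X n + 1) * (Real.log n / n) := by gcongr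
      _ = X n * Real.log n / n + Real.log n / n := by ring
      _ ≤ A + Real.log n / n := by gcongr

end IsDriven

/-! ### Conditioning on the history of the tree -/

/-- The possible histories of the tree up to time `n`. -/
abbrev Hist (n : ℕ) : Type := (k : Fin (n + 1)) → SimpleGraph (Fin (k + 1))

section History

variable {Ω : Type*} {P : (n : ℕ) → Ω → SimpleGraph (Fin (n + 1))}

/-- The history of the tree up to time `n`. -/
def hist (P : (n : ℕ) → Ω → SimpleGraph (Fin (n + 1))) (n : ℕ) (ω : Ω) : Hist n := fun k => P k ω

theorem hist_eq_iff {n : ℕ} {ω : Ω} {h : Hist n} {g : (k : ℕ) → SimpleGraph (Fin (k + 1))}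
    (hg : ∀ k : Fin (n + 1), g k = h k) : hist P n ω = h ↔ ∀ k ≤ n, P k ω = g k := by
  rw [funext_iff]
  constructor
  · intro H k hk
    have := H ⟨k, Nat.lt_succ_of_le hk⟩
    rw [← hg] at this
    exact this
  · intro H k
    rw [← hg]
    exact H k (Nat.le_of_lt_succ k.2)

theorem exists_extension {n : ℕ} (h : Hist n) :
    ∃ g : (k : ℕ) → SimpleGraph (Fin (k + 1)), ∀ k : Fin (n + 1), g k = h k :=
  ⟨fun k => if hk : k < n + 1 then h ⟨k, hk⟩ else ⊥, fun k => dif_pos k.2⟩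

theorem measurable_comap_hist {n : ℕ} {β : Type*} [MeasurableSpace β] (B : Hist n → β) :
    Measurable[MeasurableSpace.comap (hist P n) ⊤] fun ω => B (hist P n ω) := by
  intro s _
  exact ⟨B ⁻¹' s, trivial, rfl⟩

end History

variable {Ω : Type*} [MeasurableSpace Ω] {μ : Measure Ω} {d : ℕ}
  {P : (n : ℕ) → Ω → SimpleGraph (Fin (n + 1))}

/-! ### Measurability, the law of one step, and driven statistics of the tree -/

namespace IsPrefAttachTree

theorem measurableSet_hist_eq (hP : IsPrefAttachTree d μ P) {n : ℕ} (h : Hist n) :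
    MeasurableSet {ω | hist P n ω = h} := by
  obtain ⟨g, hg⟩ := exists_extension h
  have : {ω | hist P n ω = h} = ⋂ k : Fin (n + 1), {ω | P k ω = h k} := by
    ext ω
    simp [funext_iff, hist]
  rw [this]
  exact MeasurableSet.iInter fun k => hP.measurableSet_eq k (h k)

theorem measurableSet_hist_preimage (hP : IsPrefAttachTree d μ P) {n : ℕ} (s : Set (Hist n)) :
    MeasurableSet (hist P n ⁻¹' s) := by
  rw [← Set.biUnion_preimage_singleton]
  exact MeasurableSet.biUnion s.to_countable fun h _ => hP.measurableSet_hist_eq h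

/-- The filtration generated by the tree. -/
def filtration (hP : IsPrefAttachTree d μ P) : Filtration ℕ ‹MeasurableSpace Ω› where
  seq n := MeasurableSpace.comap (hist P n) ⊤
  mono' := by
    rintro n m hnm s ⟨t, -, rfl⟩
    exact ⟨(fun h : Hist m => (fun k : Fin (n + 1) => h ⟨k, by omega⟩ : Hist n)) ⁻¹' t,
      trivial, rfl⟩
  le' := by
    rintro n s ⟨t, -, rfl⟩
    exact hP.measurableSet_hist_preimage t

theorem measurable_hist (hP : IsPrefAttachTree d μ P) {n : ℕ} {β : Type*} [MeasurableSpace β]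
    (B : Hist n → β) : Measurable[hP.filtration n] fun ω => B (hist P n ω) :=
  measurable_comap_hist B

theorem measurable_apply (hP : IsPrefAttachTree d μ P) {n : ℕ} {β : Type*} [MeasurableSpace β]
    (B : SimpleGraph (Fin (n + 1)) → β) : Measurable[hP.filtration n] fun ω => B (P n ω) :=
  hP.measurable_hist fun h : Hist n => B (h (Fin.last n))

/-- Level sets of `A` are preimages under the history, so `A` is constant on each history; values
off the range are irrelevant. -/
theorem exists_eq_hist (hP : IsPrefAttachTree d μ P) {n : ℕ} {A : Ω → ℝ}
    (hA : Measurable[hP.filtration n] A) : ∃ B : Hist n → ℝ, ∀ ω, A ω = B (hist P n ω) := by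
  have h : ∀ ω ω', hist P n ω = hist P n ω' → A ω = A ω' := by
    intro ω ω' h
    obtain ⟨t, -, ht⟩ := hA (measurableSet_singleton (A ω))
    have h1 : ω ∈ hist P n ⁻¹' t := by rw [ht]; rfl
    have h2 : ω' ∈ hist P n ⁻¹' t := by
      rw [Set.mem_preimage, ← h]
      exact h1
    rw [ht] at h2
    exact (Set.mem_singleton_iff.1 h2).symm
  exact ⟨Function.extend (hist P n) A 0, fun ω =>
    (Function.FactorsThrough.extend_apply (fun ω ω' => h ω ω') 0 ω).symm⟩

/-- There are finitely many histories, so every adapted quantity is bounded. -/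
theorem integrable (hP : IsPrefAttachTree d μ P) [IsProbabilityMeasure μ] (n : ℕ) (A : Ω → ℝ)
    (hA : Measurable[hP.filtration n] A) : Integrable A μ := by
  classical
  obtain ⟨B, hB⟩ := hP.exists_eq_hist hA
  have := Fintype.ofFinite (Hist n)
  refine Integrable.of_bound (hA.mono (hP.filtration.le n) le_rfl).aestronglyMeasurable
    (∑ h, |B h|) (ae_of_all _ fun ω => ?_)
  rw [hB, Real.norm_eq_abs]
  exact Finset.single_le_sum (f := fun h => |B h|) (fun h _ => abs_nonneg _) (Finset.mem_univ _)

theorem measurableSet_attach (hP : IsPrefAttachTree d μ P) (n : ℕ) (y : Fin (n + 1)) :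
    MeasurableSet[hP.filtration (n + 1)] {ω | P (n + 1) ω = attach (P n ω) y} :=
  ⟨{h | h (Fin.last (n + 1)) = attach (h (Fin.last n).castSucc) y}, trivial, rfl⟩

theorem integral_indicator_attach (hP : IsPrefAttachTree d μ P) [IsProbabilityMeasure μ] {n : ℕ}
    (hn : 1 ≤ n) (y : Fin (n + 1)) {A : Ω → ℝ} (hA : Measurable[hP.filtration n] A) :
    ∫ ω, A ω * {ω | P (n + 1) ω = attach (P n ω) y}.indicator 1 ω ∂μ =
      ∫ ω, A ω * attachProb d (P n ω) y ∂μ := by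
  classical
  obtain ⟨B, hB⟩ := hP.exists_eq_hist hA
  have := Fintype.ofFinite (Hist n)
  -- Decompose over the finitely many histories; on each of them the claim is the defining
  -- conditional probability.
  have key : ∀ g : Ω → ℝ, Integrable g μ → ∫ ω, A ω * g ω ∂μ =
      ∑ h, B h * ∫ ω in {ω | hist P n ω = h}, g ω ∂μ := by
    intro g hg
    have h1 : ∀ ω, A ω * g ω = ∑ h, B h * {ω | hist P n ω = h}.indicator g ω := by
      intro ω
      rw [Finset.sum_eq_single (hist P n ω)]
      · rw [hB, Set.indicator_of_mem]
        rfl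
      · intro h _ hne
        rw [Set.indicator_of_notMem, mul_zero]
        exact fun h' => hne h'.symm
      · simp
    simp only [h1]
    rw [integral_finsetSum]
    · simp only [integral_const_mul, integral_indicator (hP.measurableSet_hist_eq _)]
    · exact fun h _ => (hg.indicator (hP.measurableSet_hist_eq h)).const_mul _
  have hE := hP.filtration.le _ _ (hP.measurableSet_attach n y)
  rw [key (Set.indicator _ 1) ((integrable_const (1 : ℝ)).indicator hE),
    key _ (hP.integrable n _ (hP.measurable_apply fun G => attachProb d G y))]
  refine Finset.sum_congr rfl fun h _ => ?_
  congr 1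
  obtain ⟨g, hg⟩ := exists_extension h
  have h2 : {ω | hist P n ω = h} = {ω | ∀ k ≤ n, P k ω = g k} := by
    ext ω
    exact hist_eq_iff hg
  have h3 := hP.step n hn g y
  have h4 : ∫ ω in {ω | hist P n ω = h}, attachProb d (P n ω) y ∂μ =
      ∫ ω in {ω | hist P n ω = h}, attachProb d (g n) y ∂μ := by
    refine setIntegral_congr_fun (hP.measurableSet_hist_eq h) fun ω hω => ?_
    rw [h2] at hω
    show attachProb d (P n ω) y = _
    rw [hω n le_rfl]
  rw [h4, setIntegral_const, smul_eq_mul, h2, ← h3, setIntegral_indicator hE]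
  have h5 : {ω | ∀ k ≤ n, P k ω = g k} ∩ {ω | P (n + 1) ω = attach (P n ω) y} =
      {ω | (∀ k ≤ n, P k ω = g k) ∧ P (n + 1) ω = attach (g n) y} := by
    ext ω
    simp only [Set.mem_inter_iff, Set.mem_ofPred_eq]
    refine and_congr_right fun H => ?_
    rw [H n le_rfl]
  rw [h5]
  simp

/-- The definition prescribes only the probabilities of the attachment events. They are disjoint and
these probabilities sum to 1, so almost surely one of the events occurs. -/
theorem ae_exists_attach_of_isGood (hP : IsPrefAttachTree d μ P) [IsProbabilityMeasure μ]
    (hd : 0 < d) {n : ℕ} (hn : 1 ≤ n) (hgood : ∀ᵐ ω ∂μ, IsGood n (P n ω)) :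
    ∀ᵐ ω ∂μ, ∃ y, P (n + 1) ω = attach (P n ω) y := by
  have hE := fun y => hP.filtration.le _ _ (hP.measurableSet_attach n y)
  have h1 : ∀ y, μ.real {ω | P (n + 1) ω = attach (P n ω) y} =
      ∫ ω, attachProb d (P n ω) y ∂μ := by
    intro y
    have := hP.integral_indicator_attach hn y (A := fun _ => 1) measurable_const
    simp only [one_mul] at this
    rw [← this, integral_indicator_one (hE y)]
  have h2 : μ.real (⋃ y ∈ (Finset.univ : Finset (Fin (n + 1))),
      {ω | P (n + 1) ω = attach (P n ω) y}) = 1 := by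
    rw [measureReal_biUnion_finset _ fun y _ => hE y]
    · simp only [h1]
      rw [← integral_finsetSum]
      · have : ∀ᵐ ω ∂μ, ∑ y, attachProb d (P n ω) y = 1 := by
          filter_upwards [hgood] with ω hω
          exact sum_attachProb hω hn hd
        rw [integral_congr_ae this]
        simp
      · exact fun y _ => hP.integrable n _ (hP.measurable_apply fun G => attachProb d G y)
    · intro y _ z _ hyz
      refine Set.disjoint_left.2 fun ω hy hz => hyz (attach_injective (P n ω) ?_)
      exact (Eq.symm hy).trans hz
  have h3 := (prob_compl_eq_zero_iff (μ := μ)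
    (Finset.univ.measurableSet_biUnion fun y _ => hE y)).2
    ((ENNReal.toReal_eq_one_iff _).1 h2)
  filter_upwards [compl_mem_ae_iff.2 h3] with ω hω
  simpa using hω

theorem ae_isGood (hP : IsPrefAttachTree d μ P) [IsProbabilityMeasure μ] (hd : 0 < d) :
    ∀ᵐ ω ∂μ, ∀ n, 1 ≤ n → IsGood n (P n ω) ∧ ∃ y, P (n + 1) ω = attach (P n ω) y := by
  rw [ae_all_iff]
  have h : ∀ n, 1 ≤ n → ∀ᵐ ω ∂μ, IsGood n (P n ω) := by
    intro n hn
    induction n, hn using Nat.le_induction with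
    | base =>
      filter_upwards [hP.init] with ω hω
      rw [hω]
      exact isGood_top
    | succ n hn ih =>
      filter_upwards [ih, hP.ae_exists_attach_of_isGood hd hn ih] with ω h1 ⟨y, hy⟩
      rw [hy]
      exact h1.attach y
  intro n
  by_cases hn : 1 ≤ n
  · filter_upwards [h n hn, hP.ae_exists_attach_of_isGood hd hn (h n hn)] with ω h1 h2 _
    exact ⟨h1, h2⟩
  · exact ae_of_all _ fun ω h => absurd h hn

/-- Averaging over the next step of the tree. -/
theorem integral_step (hP : IsPrefAttachTree d μ P) [IsProbabilityMeasure μ] (hd : 0 < d)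
    {n : ℕ} (hn : 1 ≤ n) {A : Ω → ℝ} (hA : Measurable[hP.filtration n] A)
    (B : SimpleGraph (Fin (n + 2)) → ℝ) :
    ∫ ω, A ω * B (P (n + 1) ω) ∂μ =
      ∫ ω, A ω * ∑ y, attachProb d (P n ω) y * B (attach (P n ω) y) ∂μ := by
  have hC : ∀ y, Measurable[hP.filtration n] fun ω => A ω * B (attach (P n ω) y) :=
    fun y => hA.mul (hP.measurable_apply fun G => B (attach G y))
  have hE := fun y => hP.filtration.le _ _ (hP.measurableSet_attach n y)
  have h1 : ∀ᵐ ω ∂μ, A ω * B (P (n + 1) ω) = ∑ y, (A ω * B (attach (P n ω) y)) *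
      {ω | P (n + 1) ω = attach (P n ω) y}.indicator 1 ω := by
    filter_upwards [hP.ae_isGood hd] with ω hω
    obtain ⟨y, hy⟩ := (hω n hn).2
    rw [Finset.sum_eq_single y]
    · rw [Set.indicator_of_mem (by exact hy), ← hy]
      simp
    · intro z _ hzy
      rw [Set.indicator_of_notMem, mul_zero]
      intro hz
      exact hzy (attach_injective _ ((Eq.symm hz).trans hy))
    · simp
  rw [integral_congr_ae h1, integral_finsetSum]
  · simp only [hP.integral_indicator_attach hn _ (hC _)]
    rw [← integral_finsetSum]
    · refine integral_congr_ae (ae_of_all _ fun ω => ?_)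
      simp only [Finset.mul_sum]
      refine Finset.sum_congr rfl fun y _ => ?_
      ring
    · exact fun y _ => hP.integrable n _
        ((hC y).mul (hP.measurable_apply fun G => attachProb d G y))
  · intro y _
    refine hP.integrable (n + 1) _ (((hC y).mono (hP.filtration.mono n.le_succ) le_rfl).mul ?_)
    exact Measurable.indicator measurable_const (hP.measurableSet_attach n y)

/-- Used for the maximum degree and for the degree of a fixed vertex. The process is started at time
`N`, when the vertex exists; `r` is the conditional mean increment. -/
theorem ae_isDriven (hP : IsPrefAttachTree d μ P) [IsProbabilityMeasure μ] (hd : 0 < d)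
    {N : ℕ} (hN : 1 ≤ N) {x : (n : ℕ) → SimpleGraph (Fin (n + 1)) → ℕ}
    {r : (n : ℕ) → SimpleGraph (Fin (n + 1)) → ℝ}
    (hx : ∀ n ≥ N, ∀ G, IsGood n G → 1 ≤ x n G ∧ x n G ≤ n)
    (hstep : ∀ n ≥ N, ∀ G, IsGood n G → ∀ y,
      x (n + 1) (attach G y) = x n G ∨ x (n + 1) (attach G y) = x n G + 1)
    (hr0 : ∀ n ≥ N, ∀ G, IsGood n G → 0 ≤ r n G)
    (hr : ∀ n ≥ N, ∀ G, IsGood n G →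
      ∑ y, attachProb d G y * ((x (n + 1) (attach G y) : ℝ) - x n G) = r n G) :
    ∀ᵐ ω ∂μ, IsDriven (fun n => x n (P n ω)) fun n => r n (P n ω) := by
  let F : Filtration ℕ ‹MeasurableSpace Ω› :=
    { seq := fun n => hP.filtration (N + n)
      mono' := fun n m h => hP.filtration.mono (by omega)
      le' := fun n => hP.filtration.le _ }
  have key := ae_tendsto_sum_log_sub F (μ := μ) (X := fun n ω => x (N + n) (P (N + n) ω))
    (p := fun n ω => r (N + n) (P (N + n) ω)) (fun n => hP.integrable (N + n))
    (fun n => hP.measurable_apply (x (N + n))) (fun n => hP.measurable_apply (r (N + n)))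
    ?_ ?_ ?_
  · filter_upwards [key, hP.ae_isGood hd] with ω ⟨l, hl⟩ hω
    refine ⟨?_, ?_, ?_, ?_⟩
    · filter_upwards [eventually_ge_atTop N] with n hn
      exact (hx n hn _ (hω n (hN.trans hn)).1).1
    · filter_upwards [eventually_ge_atTop N] with n hn
      exact (hx n hn _ (hω n (hN.trans hn)).1).2
    · filter_upwards [eventually_ge_atTop N] with n hn
      obtain ⟨h1, y, hy⟩ := hω n (hN.trans hn)
      rw [hy]
      exact hstep n hn _ h1 y
    · refine ⟨∑ k ∈ Finset.range N, (Real.log (x (k + 1) (P (k + 1) ω)) -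
        Real.log (x k (P k ω)) - r k (P k ω) / x k (P k ω)) + l, ?_⟩
      rw [← tendsto_add_atTop_iff_nat N]
      refine (hl.const_add _).congr fun n => ?_
      rw [add_comm n N, Finset.sum_range_add]
      rfl
  · filter_upwards [hP.ae_isGood hd] with ω hω n
    obtain ⟨h1, y, hy⟩ := hω (N + n) (by omega)
    refine ⟨(hx (N + n) (by omega) _ h1).1, ?_⟩
    have := hstep (N + n) (by omega) _ h1 y
    rw [← hy] at this
    exact this
  · filter_upwards [hP.ae_isGood hd] with ω hω n
    exact hr0 (N + n) (by omega) _ (hω (N + n) (by omega)).1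
  · intro n A hA
    have hXm : Measurable[hP.filtration (N + n)] fun ω => A ω * (x (N + n) (P (N + n) ω) : ℝ) :=
      hA.mul (hP.measurable_apply fun G => (x (N + n) G : ℝ))
    have hXm' : Measurable[hP.filtration (N + n + 1)] fun ω =>
        A ω * (x (N + n + 1) (P (N + n + 1) ω) : ℝ) :=
      (Measurable.mono hA (hP.filtration.mono (N + n).le_succ) le_rfl).mul
        (hP.measurable_apply fun G => (x (N + n + 1) G : ℝ))
    have hS : Measurable[hP.filtration (N + n)] fun ω => A ω * ∑ y,
        attachProb d (P (N + n) ω) y * (x (N + n + 1) (attach (P (N + n) ω) y) : ℝ) :=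
      hA.mul (hP.measurable_apply fun G => ∑ y, attachProb d G y *
        (x (N + n + 1) (attach G y) : ℝ))
    simp only [mul_sub]
    have h1 := hP.integral_step hd (n := N + n) (by omega) hA fun G => (x (N + n + 1) G : ℝ)
    rw [show N + (n + 1) = N + n + 1 from rfl,
      integral_sub (hP.integrable _ _ hXm') (hP.integrable _ _ hXm), h1,
      ← integral_sub (hP.integrable _ _ hS) (hP.integrable _ _ hXm)]
    refine integral_congr_ae ?_
    filter_upwards [hP.ae_isGood hd] with ω hω
    have h2 := (hω (N + n) (by omega)).1
    rw [← mul_sub, ← hr (N + n) (by omega) _ h2]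
    congr 1
    simp only [mul_sub, Finset.sum_sub_distrib, ← Finset.sum_mul]
    rw [sum_attachProb h2 (by omega) hd, one_mul]

end IsPrefAttachTree

/-! ### Comparison of two degrees with a Pólya urn -/

/-- The density at `1 / 2` of the beta distribution with parameters `a` and `b`, up to a factor:
a martingale for the Pólya urn with `a` and `b` balls. -/
def urn (a b : ℕ) : ℝ :=
  ((a - 1 + (b - 1) + 1).factorial : ℝ) / ((a - 1).factorial * (b - 1).factorial) /
    2 ^ (a - 1 + (b - 1))

theorem urn_pos (a b : ℕ) : 0 < urn a b := by unfold urn; positivity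

theorem urn_comm (a b : ℕ) : urn a b = urn b a := by
  unfold urn
  rw [add_comm (a - 1), mul_comm ((a - 1).factorial : ℝ)]

/-- The relative changes `(b - a) / (2a)` and `(a - b) / (2b)` average to zero under weights
proportional to `a` and `b`, which is the martingale property for the urn. -/
theorem urn_succ_left {a b : ℕ} (ha : 1 ≤ a) (hb : 1 ≤ b) :
    urn (a + 1) b = urn a b + urn a b * ((b - a) / (2 * a)) := by
  obtain ⟨a, rfl⟩ := Nat.exists_eq_add_of_le' ha
  obtain ⟨b, rfl⟩ := Nat.exists_eq_add_of_le' hb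
  simp only [urn, Nat.add_sub_cancel]
  rw [show a + 1 + b + 1 = (a + b + 1) + 1 by ring, show a + 1 + b = a + b + 1 by ring,
    Nat.factorial_succ (a + b + 1), Nat.factorial_succ a, pow_succ]
  push_cast
  have h1 : (a.factorial : ℝ) ≠ 0 := by positivity
  have h2 : (b.factorial : ℝ) ≠ 0 := by positivity
  have h3 : (a : ℝ) + 1 ≠ 0 := by positivity
  field_simp
  ring

theorem urn_succ_right {a b : ℕ} (ha : 1 ≤ a) (hb : 1 ≤ b) :
    urn a (b + 1) = urn a b + urn a b * ((a - b) / (2 * b)) := by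
  rw [urn_comm, urn_succ_left hb ha, urn_comm b a]

/-- Equivalent to `4 ^ n ≤ (2n + 1) * (2n choose n)` with `n = a - 1`. -/
theorem one_le_urn_self (a : ℕ) : 1 ≤ urn a a := by
  unfold urn
  generalize a - 1 = n
  have h1 := Nat.four_pow_le_two_mul_add_one_mul_central_binom n
  have h2 := Nat.add_choose_mul_factorial_mul_factorial n n
  rw [le_div_iff₀ (by positivity), le_div_iff₀ (by positivity), Nat.factorial_succ, ← h2, one_mul,
    ← two_mul, pow_mul]
  have h3 : ((4 ^ n : ℕ) : ℝ) ≤ (((2 * n + 1) * (2 * n).choose n : ℕ) : ℝ) := by exact_mod_cast h1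
  push_cast at h3 ⊢
  have h4 : (0 : ℝ) ≤ n.factorial * n.factorial := by positivity
  have := mul_le_mul_of_nonneg_right h3 h4
  norm_num at this ⊢
  linarith

theorem urn_one_right {a : ℕ} (ha : 1 ≤ a) : urn a 1 = a / 2 ^ (a - 1) := by
  obtain ⟨a, rfl⟩ := Nat.exists_eq_add_of_le' ha
  simp only [urn, Nat.add_sub_cancel, Nat.sub_self, add_zero, Nat.factorial_zero]
  rw [Nat.factorial_succ]
  have h1 : (a.factorial : ℝ) ≠ 0 := by positivity
  push_cast
  field_simp

/-- Exponential decay in `a` beats every power of `k ≤ a ^ 2`. The cube leaves a summable `1 / k ^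
2` after a union over `k` older vertices; the exponent 7 below is that of `a * (a ^ 2) ^ 3`. -/
theorem exists_urn_one_right_le : ∃ C : ℝ, 0 ≤ C ∧ ∀ a k : ℕ, 1 ≤ k → k ≤ a ^ 2 →
    urn a 1 ≤ C / k ^ 3 := by
  obtain ⟨C, hC⟩ := (tendsto_pow_const_div_const_pow_of_one_lt 7
    (one_lt_two (α := ℝ))).bddAbove_range
  have hC' : ∀ a : ℕ, (a : ℝ) ^ 7 / 2 ^ a ≤ C := fun a => hC ⟨a, rfl⟩
  have hC0 : 0 ≤ C := le_trans (by positivity) (hC' 0)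
  refine ⟨2 * C, by positivity, fun a k hk hka => ?_⟩
  have ha : 1 ≤ a := by
    by_contra! h
    obtain rfl : a = 0 := by omega
    omega
  rw [urn_one_right ha]
  have ha' : (0 : ℝ) < a := by exact_mod_cast ha
  have hk' : (0 : ℝ) < k := by exact_mod_cast hk
  have h1 : (k : ℝ) ≤ (a : ℝ) ^ 2 := by exact_mod_cast hka
  have h2 : (2 : ℝ) ^ a = 2 ^ (a - 1) * 2 := by rw [← pow_succ, Nat.sub_add_cancel ha]
  have h3 := hC' a
  rw [h2, div_le_iff₀ (by positivity)] at h3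
  rw [div_le_div_iff₀ (by positivity) (by positivity)]
  calc (a : ℝ) * (k : ℝ) ^ 3 ≤ (a : ℝ) * ((a : ℝ) ^ 2) ^ 3 := by gcongr
    _ = (a : ℝ) ^ 7 := by ring
    _ ≤ _ := by linarith

/-- The degree of the vertex of index `v`, with the value `1` if there is no such vertex. -/
def degAt (v : ℕ) {n : ℕ} (G : SimpleGraph (Fin (n + 1))) : ℕ :=
  if h : v < n + 1 then deg G ⟨v, h⟩ else 1

section DegAt

variable {n v : ℕ} {G : SimpleGraph (Fin (n + 1))}

theorem degAt_of_le (hv : v ≤ n) : degAt v G = deg G ⟨v, Nat.lt_succ_of_le hv⟩ :=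
  dif_pos (Nat.lt_succ_of_le hv)

theorem degAt_val (w : Fin (n + 1)) : degAt (w : ℕ) G = deg G w := dif_pos w.2

theorem degAt_attach (hv : v ≤ n) (y : Fin (n + 1)) :
    degAt v (attach G y) = degAt v G + if (y : ℕ) = v then 1 else 0 := by
  rw [degAt_of_le hv, degAt_of_le (hv.trans n.le_succ)]
  have := deg_attach_castSucc G y ⟨v, Nat.lt_succ_of_le hv⟩
  rw [Fin.castSucc_mk] at this
  rw [this]
  simp only [Fin.ext_iff, @eq_comm _ v]

theorem degAt_attach_last (y : Fin (n + 1)) : degAt (n + 1) (attach G y) = 1 := by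
  rw [degAt_of_le le_rfl]
  exact deg_attach_last G y

theorem one_le_degAt {m : ℕ} (hG : IsGood m G) (hv : v ≤ n) : 1 ≤ degAt v G := by
  rw [degAt_of_le hv]
  exact hG.one_le_deg _

theorem sum_attachProb_degAt {d : ℕ} (hv : v ≤ n) :
    ∑ y, attachProb d G y * (if (y : ℕ) = v then 1 else 0) =
      attachProb d G ⟨v, Nat.lt_succ_of_le hv⟩ := by
  rw [Finset.sum_eq_single ⟨v, Nat.lt_succ_of_le hv⟩]
  · simp
  · intro y _ hy
    rw [if_neg (fun h => hy (Fin.ext h)), mul_zero]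
  · simp

/-- The expected change is `-urn a b * ((a - b) / 2) * (pu / a - pv / b)`, and the leader `u` has
the larger attachment probability per unit of degree. -/
theorem sum_attachProb_urn_le {d m u : ℕ} (hG : IsGood m G) (hm : 0 < m) (hd : 0 < d) (hu : u ≤ n)
    (hv : v ≤ n) (huv : degAt v G < degAt u G) :
    ∑ y, attachProb d G y * urn (degAt u (attach G y)) (degAt v (attach G y)) ≤
      urn (degAt u G) (degAt v G) := by
  have ha := one_le_degAt hG hu
  have hb := one_le_degAt hG hv
  have hne : u ≠ v := by
    rintro rfl
    exact lt_irrefl _ huv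
  have hpuv : attachProb d G ⟨v, Nat.lt_succ_of_le hv⟩ * degAt u G ≤
      attachProb d G ⟨u, Nat.lt_succ_of_le hu⟩ * degAt v G := by
    rw [degAt_of_le hu, degAt_of_le hv] at *
    exact attachProb_mul_deg_le hG huv
  set a := degAt u G
  set b := degAt v G
  have h1 : ∀ y : Fin (n + 1), urn (degAt u (attach G y)) (degAt v (attach G y)) =
      urn a b + (if (y : ℕ) = u then 1 else 0) * (urn a b * ((b - a) / (2 * a))) +
        (if (y : ℕ) = v then 1 else 0) * (urn a b * ((a - b) / (2 * b))) := by
    intro y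
    rw [degAt_attach hu, degAt_attach hv]
    split_ifs with h2 h3 h3
    · exact absurd (h2.symm.trans h3) hne
    · rw [add_zero, urn_succ_left ha hb]
      ring
    · rw [add_zero, urn_succ_right ha hb]
      ring
    · simp [a, b]
  simp only [h1, mul_add, ← mul_assoc, Finset.sum_add_distrib, ← Finset.sum_mul,
    sum_attachProb_degAt hu, sum_attachProb_degAt hv, sum_attachProb hG hm hd]
  set pu := attachProb d G ⟨u, Nat.lt_succ_of_le hu⟩
  set pv := attachProb d G ⟨v, Nat.lt_succ_of_le hv⟩
  have ha' : (0 : ℝ) < a := by exact_mod_cast ha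
  have hb' : (0 : ℝ) < b := by exact_mod_cast hb
  have hab : (b : ℝ) < a := by exact_mod_cast huv
  have h3 : pv / b ≤ pu / a := by rwa [div_le_div_iff₀ hb' ha']
  have h4 : 1 * urn a b + pu * urn a b * ((b - a) / (2 * a)) + pv * urn a b * ((a - b) / (2 * b)) =
      urn a b - urn a b * ((a - b) / 2) * (pu / a - pv / b) := by
    field_simp
    ring
  rw [h4]
  have h5 : 0 ≤ urn a b * ((a - b) / 2) * (pu / a - pv / b) :=
    mul_nonneg (mul_nonneg (urn_pos a b).le (by linarith)) (by linarith)
  linarith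

end DegAt

/-! ### Catching up and the finiteness of the set of hubs -/

namespace IsPrefAttachTree

/-- A vertex `v` of lower degree than `u` is unlikely to ever reach the degree of `u`. -/
theorem measure_catch_up_le (hP : IsPrefAttachTree d μ P) [IsProbabilityMeasure μ] (hd : 0 < d)
    {N u v : ℕ} (hN : 1 ≤ N) (hu : u ≤ N) (hv : v ≤ N) {S : Set Ω}
    (hS : MeasurableSet[hP.filtration N] S) {ε : ℝ} (hε : 0 ≤ ε)
    (hlt : ∀ ω ∈ S, degAt v (P N ω) < degAt u (P N ω))
    (hle : ∀ ω ∈ S, urn (degAt u (P N ω)) (degAt v (P N ω)) ≤ ε) :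
    μ {ω | ω ∈ S ∧ ∃ n ≥ N, degAt u (P n ω) ≤ degAt v (P n ω)} ≤ ENNReal.ofReal ε := by
  classical
  -- The event that `u` has kept its lead up to time `N + i`.
  let D : ℕ → Set Ω := fun i =>
    {ω | ω ∈ S ∧ ∀ j ≤ i, degAt v (P (N + j) ω) < degAt u (P (N + j) ω)}
  have hD0 : D 0 = S := by
    ext ω
    simp only [D, Set.mem_ofPred_eq]
    constructor
    · exact fun h => h.1
    · refine fun h => ⟨h, fun j hj => ?_⟩
      obtain rfl : j = 0 := by omega
      exact hlt ω h
  have hDs : ∀ i, D (i + 1) =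
      D i ∩ {ω | degAt v (P (N + i + 1) ω) < degAt u (P (N + i + 1) ω)} := by
    intro i
    ext ω
    simp only [D, Set.mem_ofPred_eq, Set.mem_inter_iff]
    constructor
    · exact fun h => ⟨⟨h.1, fun j hj => h.2 j (by omega)⟩, h.2 (i + 1) le_rfl⟩
    · refine fun h => ⟨h.1.1, fun j hj => ?_⟩
      rcases Nat.le_succ_iff.1 hj with hj | rfl
      · exact h.1.2 j hj
      · exact h.2
  have hDm : ∀ i, MeasurableSet[hP.filtration (N + i)] (D i) := by
    intro i
    induction i with
    | zero =>
      rw [hD0]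
      exact hS
    | succ i ih =>
      rw [hDs]
      refine MeasurableSet.inter (hP.filtration.mono (N + i).le_succ _ ih) ?_
      exact ⟨{h | degAt v (h (Fin.last (N + i + 1))) < degAt u (h (Fin.last (N + i + 1)))},
        trivial, rfl⟩
  have hDm' : ∀ i, MeasurableSet (D i) := fun i => hP.filtration.le _ _ (hDm i)
  have hDS : ∀ i, D i ⊆ S := fun i ω h => h.1
  have hDanti : ∀ i, D (i + 1) ⊆ D i := fun i => by rw [hDs]; exact Set.inter_subset_left
  let h : ℕ → Ω → ℝ := fun n ω => urn (degAt u (P n ω)) (degAt v (P n ω))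
  have hhm : ∀ n, Measurable[hP.filtration n] (h n) :=
    fun n => hP.measurable_apply fun G => urn (degAt u G) (degAt v G)
  have hhi : ∀ i n, N + i ≤ n → Integrable (fun ω => (D i).indicator 1 ω * h n ω) μ := by
    intro i n hin
    have h1 : Measurable[hP.filtration n] ((D i).indicator (1 : Ω → ℝ)) :=
      Measurable.indicator measurable_const (hP.filtration.mono hin _ (hDm i))
    exact hP.integrable n _ (h1.mul (hhm n))
  -- Optional stopping by hand: when the lead is lost, the urn value, at least 1, pays for the
  -- probability moved to `S \ D i`.
  have key : ∀ i, ∫ ω, (D i).indicator 1 ω * h (N + i) ω ∂μ + μ.real (S \ D i) ≤ ε := by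
    intro i
    induction i with
    | zero =>
      rw [hD0, Set.sdiff_self, measureReal_empty, add_zero]
      have := integral_mono (μ := μ) (hhi 0 N le_rfl) (integrable_const ε) fun ω => by
        rw [hD0]
        by_cases hω : ω ∈ S
        · simpa [hω] using hle ω hω
        · simpa [hω] using hε
      rw [hD0] at this
      simpa using this
    | succ i ih =>
      refine le_trans ?_ ih
      have h1 : S \ D (i + 1) = (S \ D i) ∪ (D i \ D (i + 1)) := by
        ext ω
        have := @hDanti i ω
        have := @hDS i ω
        simp only [Set.mem_sdiff, Set.mem_union]
        tauto
      have h2 : Disjoint (S \ D i) (D i \ D (i + 1)) :=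
        Set.disjoint_left.2 fun ω h1 h2 => h1.2 h2.1
      have hdm := (hDm' i).diff (hDm' (i + 1))
      rw [h1, measureReal_union h2 hdm, add_comm (μ.real (S \ D i)), ← add_assoc]
      refine add_le_add ?_ le_rfl
      have hdi : Integrable ((D i \ D (i + 1)).indicator (1 : Ω → ℝ)) μ :=
        (integrable_const (1 : ℝ)).indicator hdm
      rw [← integral_indicator_one hdm, ← integral_add (hhi (i + 1) _ le_rfl) hdi]
      have h3 : ∫ ω, ((D (i + 1)).indicator 1 ω * h (N + (i + 1)) ω +
          (D i \ D (i + 1)).indicator 1 ω) ∂μ ≤ ∫ ω, (D i).indicator 1 ω * h (N + i + 1) ω ∂μ := by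
        refine integral_mono_ae ((hhi (i + 1) _ le_rfl).add hdi) (hhi i _ (by omega)) ?_
        filter_upwards [hP.ae_isGood hd] with ω hω
        obtain ⟨hgood, y, hy⟩ := hω (N + i) (by omega)
        by_cases hi : ω ∈ D i
        swap
        · have hi' : ω ∉ D (i + 1) := fun h => hi (hDanti i h)
          simp [hi, hi']
        by_cases hi' : ω ∈ D (i + 1)
        · simp [hi, hi', add_assoc]
        have h4 : degAt v (P (N + i) ω) < degAt u (P (N + i) ω) := hi.2 i le_rfl
        have h5 : degAt u (P (N + i + 1) ω) ≤ degAt v (P (N + i + 1) ω) := by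
          by_contra! h5
          exact hi' (by rw [hDs]; exact ⟨hi, h5⟩)
        -- A step raises a degree by at most one, so the first catch-up is an exact tie.
        have h6 : degAt u (P (N + i + 1) ω) = degAt v (P (N + i + 1) ω) := by
          rw [hy, degAt_attach (by omega), degAt_attach (by omega)] at h5 ⊢
          split_ifs at h5 ⊢ <;> omega
        have h7 : 1 ≤ h (N + i + 1) ω := by
          simp only [h]
          rw [h6]
          exact one_le_urn_self _
        simpa [hi, hi'] using h7
      refine h3.trans ?_
      have h8 := hP.integral_step hd (n := N + i) (by omega)
        (Measurable.indicator (f := (1 : Ω → ℝ)) measurable_const (hDm i))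
        fun G => urn (degAt u G) (degAt v G)
      rw [h8]
      refine integral_mono_ae (hP.integrable (N + i) _ ?_) (hhi i _ le_rfl) ?_
      · exact Measurable.mul (Measurable.indicator measurable_const (hDm i))
          (hP.measurable_apply fun G => ∑ y, attachProb d G y *
            urn (degAt u (attach G y)) (degAt v (attach G y)))
      · filter_upwards [hP.ae_isGood hd] with ω hω
        by_cases hi : ω ∈ D i
        · have := sum_attachProb_urn_le (d := d) (hω (N + i) (by omega)).1 (by omega) hd
            (hu.trans (Nat.le_add_right N i)) (hv.trans (Nat.le_add_right N i)) (hi.2 i le_rfl)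
          simpa [hi] using this
        · simp [hi]
  have hsub : {ω | ω ∈ S ∧ ∃ n ≥ N, degAt u (P n ω) ≤ degAt v (P n ω)} ⊆ ⋃ i, S \ D i := by
    rintro ω ⟨hω, n, hn, hn'⟩
    refine Set.mem_iUnion.2 ⟨n - N, hω, fun h => ?_⟩
    have := h.2 (n - N) le_rfl
    rw [Nat.add_sub_cancel' hn] at this
    omega
  refine (measure_mono hsub).trans (le_of_tendsto' (tendsto_measure_iUnion_atTop ?_) fun i => ?_)
  · exact monotone_nat_of_le_succ fun i => Set.sdiff_subset_sdiff_right (hDanti i)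
  · rw [Function.comp_apply, ← ofReal_measureReal]
    refine ENNReal.ofReal_le_ofReal (le_trans ?_ (key i))
    refine le_add_of_nonneg_left (integral_nonneg fun ω => mul_nonneg ?_ (urn_pos _ _).le)
    exact Set.indicator_nonneg (fun _ _ => zero_le_one) ω

/-- If the largest degree grows fast enough, then it is always attained by one of finitely many
vertices. -/
theorem ae_exists_hubs (hP : IsPrefAttachTree d μ P) [IsProbabilityMeasure μ] (hd : 0 < d)
    (hgrow : ∀ᵐ ω ∂μ, ∀ᶠ k in atTop, k ≤ maxDeg (P k ω) ^ 2) :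
    ∀ᵐ ω ∂μ, ∃ K, ∀ n ≥ K, ∃ v < K, v ≤ n ∧ maxDeg (P n ω) = degAt v (P n ω) := by
  obtain ⟨C, hC0, hC⟩ := exists_urn_one_right_le
  -- Vertex `k` is born at time `k` with degree 1, facing an older vertex `u` of degree at least the
  -- square root of `k`.
  let S : ℕ → ℕ → Set Ω := fun k u => {ω | degAt k (P k ω) = 1 ∧ k ≤ degAt u (P k ω) ^ 2}
  let bad : ℕ → Set Ω := fun k => ⋃ u ∈ Finset.range k,
    {ω | ω ∈ S k u ∧ ∃ n ≥ k, degAt u (P n ω) ≤ degAt k (P n ω)}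
  have hbad : ∀ k ≥ 2, μ (bad k) ≤ ENNReal.ofReal (C / k ^ 2) := by
    intro k hk
    have hk0 : (0 : ℝ) < k := by exact_mod_cast (by omega : 0 < k)
    have h1 : ∀ u ∈ Finset.range k, μ {ω | ω ∈ S k u ∧ ∃ n ≥ k, degAt u (P n ω) ≤
        degAt k (P n ω)} ≤ ENNReal.ofReal (C / k ^ 3) := by
      intro u hu
      refine hP.measure_catch_up_le hd (by omega) (Finset.mem_range.1 hu).le le_rfl ?_
        (by positivity) ?_ ?_
      · exact ⟨{h | degAt k (h (Fin.last k)) = 1 ∧ k ≤ degAt u (h (Fin.last k)) ^ 2}, trivial, rfl⟩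
      · rintro ω ⟨h1, h2⟩
        rw [h1]
        by_contra! h3
        have := Nat.pow_le_pow_left h3 2
        omega
      · rintro ω ⟨h1, h2⟩
        rw [h1]
        exact hC _ _ (by omega) h2
    refine (measure_biUnion_finset_le _ _).trans ((Finset.sum_le_sum h1).trans ?_)
    rw [Finset.sum_const, Finset.card_range, ← ENNReal.ofReal_nsmul, nsmul_eq_mul]
    refine ENNReal.ofReal_le_ofReal (le_of_eq ?_)
    field_simp
  have hsum : ∑' k, μ (bad (k + 2)) ≠ ⊤ := by
    have h1 : Summable fun k : ℕ => C / ((k + 2 : ℕ) : ℝ) ^ 2 := by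
      simp only [div_eq_mul_inv]
      exact ((summable_nat_add_iff (f := fun k : ℕ => ((k : ℝ) ^ 2)⁻¹) 2).2
        (Real.summable_nat_pow_inv.2 one_lt_two)).mul_left C
    exact ne_top_of_le_ne_top h1.tsum_ofReal_ne_top
      (ENNReal.tsum_le_tsum fun k => hbad (k + 2) (by omega))
  filter_upwards [hgrow, hP.ae_isGood hd, ae_eventually_notMem hsum] with ω hg hω hb
  obtain ⟨K, hK⟩ := eventually_atTop.1 (hg.and hb)
  -- Late vertices stay strictly below the maximum for ever: a maximal vertex at their birth is
  -- never caught by them.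
  have hlead : ∀ k ≥ K + 2, ∀ n ≥ k, degAt k (P n ω) < maxDeg (P n ω) := by
    intro k hk n hn
    obtain ⟨j, rfl⟩ := Nat.exists_eq_add_of_le' (show 2 ≤ k by omega)
    have h1 : degAt (j + 2) (P (j + 2) ω) = 1 := by
      obtain ⟨y, hy⟩ := (hω (j + 1) (by omega)).2
      rw [hy]
      exact degAt_attach_last y
    have h2 := (hK (j + 2) (by omega)).1
    obtain ⟨w, hw⟩ := exists_deg_eq_maxDeg (P (j + 2) ω)
    rw [← hw, ← degAt_val] at h2
    have h3 : (w : ℕ) < j + 2 := by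
      refine lt_of_le_of_ne (Nat.le_of_lt_succ w.2) fun h => ?_
      rw [h, h1] at h2
      omega
    have h4 := (hK j (by omega)).2
    simp only [bad, Set.mem_iUnion, Finset.mem_range, not_exists] at h4
    have h5 : ∀ n ≥ j + 2, degAt (j + 2) (P n ω) < degAt (w : ℕ) (P n ω) := by
      intro n hn
      by_contra! h5
      exact h4 w h3 ⟨⟨h1, h2⟩, n, hn, h5⟩
    refine (h5 n hn).trans_le ?_
    rw [degAt_of_le (h3.le.trans hn)]
    exact deg_le_maxDeg _ _
  refine ⟨K + 2, fun n hn => ?_⟩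
  obtain ⟨w, hw⟩ := exists_deg_eq_maxDeg (P n ω)
  have hwn : (w : ℕ) ≤ n := Nat.le_of_lt_succ w.2
  rw [← degAt_val] at hw
  refine ⟨w, ?_, hwn, hw.symm⟩
  by_contra! h
  have := hlead w h n hwn
  omega

end IsPrefAttachTree

/-! ### The largest degree -/

theorem continuous_rate (d : ℕ) : Continuous (rate d) := by
  unfold rate
  fun_prop

/-- The rate falls from `d / 2 > 1` at 0 to `1 / 2` at 2, where only the constant term survives. -/
theorem exists_rate_eq_one {d : ℕ} (hd : 2 < d) : ∃ x : ℝ, 0 < x ∧ x < 2 ∧ rate d x = 1 := by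
  have h0 : 1 < rate d 0 := by
    have : (2 : ℝ) < d := by exact_mod_cast hd
    simp [rate]
    linarith
  have h2 : rate d 2 < 1 := by
    obtain ⟨d, rfl⟩ := Nat.exists_eq_add_of_le' (show 1 ≤ d by omega)
    simp [rate, Finset.sum_range_succ']
    norm_num
  obtain ⟨x, hx, hx1⟩ := intermediate_value_Icc' zero_le_two (continuous_rate d).continuousOn
    ⟨h2.le, h0.le⟩
  refine ⟨x, lt_of_le_of_ne hx.1 ?_, lt_of_le_of_ne hx.2 ?_, hx1⟩
  · rintro rfl
    linarith
  · rintro rfl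
    linarith

theorem fixed_iff_rate_eq_one {d : ℕ} {x : ℝ} (hx : 0 < x) :
    1 - (1 - x / 2) ^ d = x ↔ rate d x = 1 := by
  rw [← mul_rate, mul_eq_left₀ hx.ne']

theorem eq_of_rate_eq_one {d : ℕ} (hd : 2 ≤ d) {x y : ℝ} (hx2 : x ≤ 2) (hy2 : y ≤ 2)
    (hx : rate d x = 1) (hy : rate d y = 1) : x = y := by
  rcases lt_trichotomy x y with h | h | h
  · linarith [rate_strictAnti hd h hy2]
  · exact h
  · linarith [rate_strictAnti hd h hx2]

/-! ### Drift bounds for the degrees and convergence of the maximum -/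

namespace IsPrefAttachTree

theorem ae_maxDeg_isDriven (hP : IsPrefAttachTree d μ P) [IsProbabilityMeasure μ] (hd : 0 < d) :
    ∀ᵐ ω ∂μ, ∃ p, IsDriven (fun n => maxDeg (P n ω)) p ∧
      ∀ᶠ n : ℕ in atTop, 1 - (1 - (maxDeg (P n ω) : ℝ) / (2 * n)) ^ d ≤ p n := by
  have h := hP.ae_isDriven hd (N := 1) le_rfl (x := fun n G => maxDeg G)
    (r := fun n G => ∑ y, attachProb d G y * if deg G y = maxDeg G then 1 else 0) ?_ ?_ ?_ ?_
  · filter_upwards [h, hP.ae_isGood hd] with ω h hω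
    refine ⟨_, h, ?_⟩
    filter_upwards [eventually_ge_atTop 1] with n hn
    obtain ⟨u, hu⟩ := exists_deg_eq_maxDeg (P n ω)
    exact le_sum_attachProb_maxDeg (hω n hn).1 hn hd u hu
  · intro n _ G hG
    obtain ⟨u, hu⟩ := exists_deg_eq_maxDeg G
    rw [← hu]
    exact ⟨hG.one_le_deg u, Nat.le_of_lt_succ (deg_lt G u)⟩
  · intro n _ G hG y
    rw [maxDeg_attach hG]
    split_ifs <;> simp
  · intro n _ G hG
    exact Finset.sum_nonneg fun y _ => mul_nonneg (attachProb_nonneg y) (by split_ifs <;> simp)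
  · intro n _ G hG
    refine Finset.sum_congr rfl fun y _ => ?_
    rw [maxDeg_attach hG]
    split_ifs <;> simp

theorem ae_degAt_isDriven (hP : IsPrefAttachTree d μ P) [IsProbabilityMeasure μ] (hd : 0 < d)
    (v : ℕ) : ∀ᵐ ω ∂μ, ∃ p, IsDriven (fun n => degAt v (P n ω)) p ∧
      ∀ᶠ n : ℕ in atTop, p n ≤ 1 - (1 - (degAt v (P n ω) : ℝ) / (2 * n)) ^ d := by
  have h := hP.ae_isDriven hd (N := max v 1) (le_max_right _ _) (x := fun n G => degAt v G)
    (r := fun n G => ∑ y, attachProb d G y * if (y : ℕ) = v then 1 else 0) ?_ ?_ ?_ ?_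
  · filter_upwards [h, hP.ae_isGood hd] with ω h hω
    refine ⟨_, h, ?_⟩
    filter_upwards [eventually_ge_atTop (max v 1)] with n hn
    obtain ⟨hv, hn⟩ := max_le_iff.1 hn
    rw [sum_attachProb_degAt hv, degAt_of_le hv]
    exact attachProb_le (hω n hn).1 hn hd _
  · intro n hn G hG
    obtain ⟨hv, hn⟩ := max_le_iff.1 hn
    refine ⟨one_le_degAt hG hv, ?_⟩
    rw [degAt_of_le hv]
    exact Nat.le_of_lt_succ (deg_lt G _)
  · intro n hn G hG y
    rw [degAt_attach (max_le_iff.1 hn).1]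
    split_ifs <;> simp
  · intro n _ G hG
    exact Finset.sum_nonneg fun y _ => mul_nonneg (attachProb_nonneg y) (by split_ifs <;> simp)
  · intro n hn G hG
    refine Finset.sum_congr rfl fun y _ => ?_
    rw [degAt_attach (max_le_iff.1 hn).1]
    split_ifs <;> simp

/-- The largest degree, suitably normalized, converges if it has the right asymptotic lower bound,
and each fixed degree the right asymptotic upper bound. -/
theorem ae_tendsto_maxDeg (hP : IsPrefAttachTree d μ P) [IsProbabilityMeasure μ] (hd : 0 < d)
    {c : ℕ → ℝ} {a : ℝ} (hgrow : ∀ᵐ ω ∂μ, ∀ᶠ k in atTop, k ≤ maxDeg (P k ω) ^ 2)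
    (hlow : ∀ᵐ ω ∂μ, ∀ b < a, ∀ᶠ n in atTop, b < maxDeg (P n ω) * c n)
    (hup : ∀ v, ∀ᵐ ω ∂μ, ∀ b > a, ∀ᶠ n in atTop, degAt v (P n ω) * c n < b) :
    ∀ᵐ ω ∂μ, Tendsto (fun n => maxDeg (P n ω) * c n) atTop (𝓝 a) := by
  filter_upwards [hP.ae_exists_hubs hd hgrow, hlow, ae_all_iff.2 hup] with ω ⟨K, hK⟩ hl hu
  refine tendsto_order.2 ⟨hl, fun b hb => ?_⟩
  -- The maximum is attained among the vertices below `K`, so finitely many individual bounds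
  -- suffice.
  filter_upwards [(Finset.range K).eventually_all.2 fun v _ => hu v b hb, eventually_ge_atTop K]
    with n h1 hn
  obtain ⟨v, hvK, -, hv⟩ := hK n hn
  rw [hv]
  exact h1 v (Finset.mem_range.2 hvK)

theorem ae_tendsto_maxDeg_div (hP : IsPrefAttachTree d μ P) [IsProbabilityMeasure μ]
    (hd : 2 < d) {x : ℝ} (hx0 : 0 < x) (hx2 : x < 2) (hx : rate d x = 1) :
    ∀ᵐ ω ∂μ, Tendsto (fun n : ℕ => (maxDeg (P n ω) : ℝ) / n) atTop (𝓝 x) := by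
  have hlow : ∀ᵐ ω ∂μ, ∀ b < x, ∀ᶠ n : ℕ in atTop, b < (maxDeg (P n ω) : ℝ) / n := by
    filter_upwards [hP.ae_maxDeg_isDriven (by omega)] with ω ⟨p, h, hp⟩ b hb
    obtain ⟨A, hA1, hA2⟩ := exists_between (max_lt hb hx0)
    obtain ⟨hA1, hA0⟩ := max_lt_iff.1 hA1
    exact h.eventually_lt_div hp hA0 (by linarith)
      (by linarith [rate_strictAnti hd.le hA2 hx2.le]) hA1
  simp only [div_eq_mul_inv] at hlow ⊢
  refine hP.ae_tendsto_maxDeg (by omega) ?_ hlow fun v => ?_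
  -- Linear growth `M_n > (x / 2) n` gives `n ≤ M_n ^ 2` as soon as `n ≥ (x / 2)⁻²`.
  · filter_upwards [hlow] with ω h
    have h1 : ∀ᶠ n : ℕ in atTop, ((x / 2) ^ 2)⁻¹ ≤ (n : ℝ) :=
      tendsto_natCast_atTop_atTop.eventually_ge_atTop _
    filter_upwards [h (x / 2) (by linarith), h1, eventually_ge_atTop 1] with n h2 h3 hn
    have hn' : (0 : ℝ) < n := by exact_mod_cast hn
    rw [← div_eq_mul_inv, lt_div_iff₀ hn'] at h2
    rw [inv_le_iff_one_le_mul₀ (by positivity)] at h3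
    have : (n : ℝ) ≤ (maxDeg (P n ω) : ℝ) ^ 2 := by
      calc (n : ℝ) = n * 1 := (mul_one _).symm
        _ ≤ n * (n * (x / 2) ^ 2) := by gcongr
        _ = (x / 2 * n) ^ 2 := by ring
        _ ≤ _ := by gcongr
    exact_mod_cast this
  · filter_upwards [hP.ae_degAt_isDriven (by omega) v] with ω ⟨p, h, hp⟩ b hb
    obtain ⟨A, hA1, hA2⟩ := exists_between (lt_min hb hx2)
    obtain ⟨hA2, hA3⟩ := lt_min_iff.1 hA2
    have := h.eventually_div_lt hp (hx0.trans hA1)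
      (by linarith [rate_strictAnti hd.le hA1 hA3.le]) hA2
    simpa only [div_eq_mul_inv] using this

theorem ae_tendsto_maxDeg_mul_log_div (hP : IsPrefAttachTree 2 μ P) [IsProbabilityMeasure μ] :
    ∀ᵐ ω ∂μ, Tendsto (fun n : ℕ => (maxDeg (P n ω) : ℝ) * Real.log n / n) atTop (𝓝 4) := by
  have hlow : ∀ᵐ ω ∂μ, ∀ b < (4 : ℝ), ∀ᶠ n : ℕ in atTop,
      b < (maxDeg (P n ω) : ℝ) * Real.log n / n := by
    filter_upwards [hP.ae_maxDeg_isDriven two_pos] with ω ⟨p, h, hp⟩ b hb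
    obtain ⟨A, hA1, hA2⟩ := exists_between (max_lt hb four_pos)
    obtain ⟨hA1, hA0⟩ := max_lt_iff.1 hA1
    exact h.eventually_lt_mul_log_div hp hA0 hA2 hA1
  simp only [mul_div_assoc] at hlow ⊢
  refine hP.ae_tendsto_maxDeg two_pos ?_ hlow fun v => ?_
  -- From `M_n log n > n` and `(log n) ^ 2 ≤ n` it follows that `n ≤ M_n ^ 2`.
  · filter_upwards [hlow] with ω h
    have h1 : ∀ᶠ n : ℕ in atTop, Real.log n ^ 2 ≤ n := by
      have := (Real.isLittleO_pow_log_id_atTop (n := 2)).bound one_pos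
      filter_upwards [tendsto_natCast_atTop_atTop.eventually this] with n hn
      simpa using hn
    filter_upwards [h 1 (by norm_num), h1, eventually_ge_atTop 1] with n h2 h3 hn
    have hn' : (0 : ℝ) < n := by exact_mod_cast hn
    rw [← mul_div_assoc, lt_div_iff₀ hn', one_mul] at h2
    have h4 : (n : ℝ) * n ≤ (maxDeg (P n ω) : ℝ) ^ 2 * n := by
      calc (n : ℝ) * n = n ^ 2 := (sq _).symm
        _ ≤ (maxDeg (P n ω) * Real.log n) ^ 2 := by gcongr
        _ = (maxDeg (P n ω) : ℝ) ^ 2 * Real.log n ^ 2 := mul_pow _ _ _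
        _ ≤ _ := by gcongr
    exact_mod_cast le_of_mul_le_mul_right h4 hn'
  · filter_upwards [hP.ae_degAt_isDriven two_pos v] with ω ⟨p, h, hp⟩ b hb
    obtain ⟨A, hA1, hA2⟩ := exists_between hb
    have := h.eventually_mul_log_div_lt hp hA1 hA2
    simpa only [mul_div_assoc] using this

end IsPrefAttachTree

end MaxChoice

end

theorem theorem1p1 {Ω : Type*} [MeasurableSpace Ω] (μ : Measure Ω) [IsProbabilityMeasure μ]
    (d : ℕ) (P : (n : ℕ) → Ω → SimpleGraph (Fin (n + 1)))
    (hP : MaxChoice.IsPrefAttachTree d μ P) :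
    (d = 2 → ∀ᵐ ω ∂μ,
      Tendsto (fun n : ℕ => (MaxChoice.maxDeg (P n ω) : ℝ) * Real.log (n : ℝ) / (n : ℝ))
        atTop (𝓝 4)) ∧
    (2 < d →
      (∃! x : ℝ, 0 < x ∧ x ≤ 2 ∧ 1 - (1 - x / 2) ^ d = x) ∧
      ∀ x : ℝ, 0 < x → x ≤ 2 → 1 - (1 - x / 2) ^ d = x →
        ∀ᵐ ω ∂μ, Tendsto (fun n : ℕ => (MaxChoice.maxDeg (P n ω) : ℝ) / (n : ℝ))
          atTop (𝓝 x)) := by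
  refine ⟨?_, fun hd => ?_⟩
  · rintro rfl
    exact hP.ae_tendsto_maxDeg_mul_log_div
  · obtain ⟨x, hx0, hx2, hx⟩ := MaxChoice.exists_rate_eq_one hd
    have huniq : ∀ y : ℝ, 0 < y → y ≤ 2 → 1 - (1 - y / 2) ^ d = y → y = x := fun y hy0 hy2 hy =>
      MaxChoice.eq_of_rate_eq_one hd.le hy2 hx2.le
        ((MaxChoice.fixed_iff_rate_eq_one hy0).1 hy) hx
    refine ⟨⟨x, ⟨hx0, hx2.le, (MaxChoice.fixed_iff_rate_eq_one hx0).2 hx⟩,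
      fun y hy => huniq y hy.1 hy.2.1 hy.2.2⟩, fun y hy0 hy2 hy => ?_⟩
    rw [huniq y hy0 hy2 hy]
    exact hP.ae_tendsto_maxDeg_div hd hx0 hx2 hx
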